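/- Let $\mathbb{T}=\{z\in\mathbb{C}:|z|=1\}$ and $S^1=\mathbb{T}$, parametrized and oriented by $t\mapsto e^{2\pi i t}$, and let $L\mathbb{T}=C^\infty(S^1,\mathbb{T})$ be the loop group. For a manifold $X$ let $H^q(X,\mathbb{Z}(p))$ be smooth Deligne cohomology: the direct limit over the open covers $\{U_a\}$ of $X$ of the cohomology of the total Čech complex of $\mathbb{Z}\to A^0\to\dots\to A^{p-1}$, with total differential $\delta+(-1)^i d$ in Čech degree $i$ (where $d$ in degree $0$ is the inclusion $\mathbb{Z}\to A^0$). Put $\mathcal{G}(S^1)=H^1(S^1,\mathbb{Z}(1))$; its elements are represented by cocycles $(k_{ab},\tau_a)$. The cup product $H^1(X,\mathbb{Z}(1))\times H^1(X,\mathbb{Z}(1))\to H^2(X,\mathbb{Z}(2))$ is induced by $$(k,\tau)\cup(m,\theta)=(k_{ab}m_{bc},\;k_{ab}\theta_b,\;\tau_a\,d\theta_a).$$ The integration $\int_{S^1}:H^2(S^1,\mathbb{Z}(2))\to\mathbb{R}/\mathbb{Z}$ is defined as follows. Choose a triangulation of $S^1$ and for each edge $e$ and each vertex $v$ a member $U_{\phi(e)}\supset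 e$, $U_{\phi(v)}\ni v$ of the cover; the class of $(n,\omega^0,\omega^1)$ is sent to $$\sum_{e=[v,w]}\Big(\int_e\omega^1_{\phi(e)}+\omega^0_{\phi(e)\phi(w)}(w)-\omega^0_{\phi(e)\phi(v)}(v)\Big)\bmod\mathbb{Z}.$$ Put $S(f,g)=\int_{S^1}f\cup g$, and let $\widetilde{\mathcal{G}}(S^1)=\mathcal{G}(S^1)\times\mathbb{T}$ be the central extension of $\mathcal{G}(S^1)$ by $\mathbb{T}$ with $(f,u)(g,v)=(f+g,\,uv\,e^{2\pi i S(f,g)})$. For $f\in L\mathbb{T}$ choose a smooth $F:\mathbb{R}\to\mathbb{R}$ with $f(e^{2\pi i t})=e^{2\pi i F(t)}$, and put $\Delta_F=F(1)-F(0)$, $\overline{F}=\int_0^1F(t)\,dt$. Let $$c(f,g)=\tfrac12\Big\{\int_0^1F(t)G'(t)\,dt+\overline{F}\,\Delta_G+\Delta_F(\overline{G}-G(0))\Big\}\bmod\mathbb{Z},\qquad T(f)=\Delta_F\overline{F}\bmod\mathbb{Z};$$ these do not depend on the choice of the lifts. Let $\widehat{L\mathbb{T}}$ be the universal central extension of $L\mathbb{T}$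 of Pressley and Segal, that is, the central extension by $\mathbb{T}$ defined by the 2-cocycle $c$: the set $L\mathbb{T}\times\mathbb{T}$ with $(f,u)(g,v)=(fg,\,uv\,e^{2\pi i c(f,g)})$. Let $\mathbb{Z}_2=\{\pm1\}\subset\mathbb{T}\subset\widehat{L\mathbb{T}}$, and regard $\widehat{L\mathbb{T}}/\mathbb{Z}_2$ as a central extension of $L\mathbb{T}$ by $\mathbb{T}/\mathbb{Z}_2\cong\mathbb{T}$, $[u]\mapsto u^2$. **Proposition.** There is an isomorphism $e:\mathcal{G}(S^1)\to L\mathbb{T}$ that takes the class of a cocycle $(k_{ab},\tau_a)$ to the loop which is $e^{2\pi i\tau_a}$ on $U_a$, such that the following hold. 1. For $f,g\in\mathcal{G}(S^1)$ and all smooth lifts $F,G$ of $e(f),e(g)$, $$S(f,g)=\int_0^1F(t)G'(t)\,dt-\Delta_F\,G(0)\bmod\mathbb{Z}.$$ 2. For $f,g\in\mathcal{G}(S^1)$, $\;S(f,g)-2c(e(f),e(g))=T(e(g))-T(e(f)e(g))+T(e(f))$. 3. There is an isomorphism of groups $\Phi:\widetilde{\mathcal{G}}(S^1)\to\widehat{L\mathbb{T}}/\mathbb{Z}_2$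 which is the identity on the central subgroups $\mathbb{T}$ and covers $e$; that is, the two central extensions are isomorphic over $e$. -/

import Mathlib

open scoped Manifold ContDiff
open Set

namespace SmoothDeligne

section Presheaves

variable {X : Type*} [TopologicalSpace X] {V : X → Type*} [∀ x, AddCommGroup (V x)]

/-- Restriction to `W`. A section over an open set `W` is recorded as its extension by zero to the
whole space, so that sections over `W` are honest functions on `W`. -/
noncomputable def res (W : TopologicalSpace.Opens X) (f : ∀ x, V x) : ∀ x, V x :=
  open Classical in fun x => if x ∈ W then f x else 0

theorem res_apply {W : TopologicalSpace.Opens X} (f : ∀ x, V x) {x : X} (hx : x ∈ W) :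
    res W f x = f x := by
  simp [res, hx]

theorem res_apply_of_notMem {W : TopologicalSpace.Opens X} (f : ∀ x, V x) {x : X} (hx : x ∉ W) :
    res W f x = 0 := by
  simp [res, hx]

variable (V) in
/-- A presheaf of groups of sections of the family `V`, with the restriction maps above. -/
structure SectionPresheaf where
  sec : TopologicalSpace.Opens X → AddSubgroup (∀ x, V x)
  zero_off : ∀ {W : TopologicalSpace.Opens X} {f : ∀ x, V x}, f ∈ sec W → ∀ x ∉ W, f x = 0
  res_mem : ∀ {W W' : TopologicalSpace.Opens X}, W' ≤ W →
    ∀ {f : ∀ x, V x}, f ∈ sec W → res W' f ∈ sec W'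

variable (F : SectionPresheaf V)

/-- The restriction map `Γ(W, F) → Γ(W', F)` for `W' ⊆ W`. -/
noncomputable def SectionPresheaf.restr {W W' : TopologicalSpace.Opens X} (h : W' ≤ W) :
    F.sec W →+ F.sec W' where
  toFun f := ⟨res W' f.1, F.res_mem h f.2⟩
  map_zero' := by ext x; simp [res]
  map_add' f g := by
    ext x
    by_cases hx : x ∈ W' <;> simp [res, hx]

theorem SectionPresheaf.restr_apply {W W' : TopologicalSpace.Opens X} (h : W' ≤ W) (f : F.sec W)
    {x : X} (hx : x ∈ W') : (F.restr h f).1 x = f.1 x :=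
  res_apply f.1 hx

variable {F} in
theorem SectionPresheaf.sec_ext {W : TopologicalSpace.Opens X} {f g : F.sec W}
    (h : ∀ x ∈ W, f.1 x = g.1 x) : f = g := by
  apply Subtype.ext
  funext x
  by_cases hx : x ∈ W
  · exact h x hx
  · rw [F.zero_off f.2 x hx, F.zero_off g.2 x hx]

end Presheaves

section Covers

/-- An open cover of `X` indexed by the points of `X`, with `x ∈ U x`. Every open cover is refined
by one of this kind, and on these covers the refinement maps can be taken to be the identity on
indices, so that the direct limit over all open covers can be computed with them. -/
@[ext] structure PointedCover (X : Type*) [TopologicalSpace X] where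
  U : X → TopologicalSpace.Opens X
  mem : ∀ x, x ∈ U x

variable {X : Type*} [TopologicalSpace X]

/-- `𝔘 ≤ 𝔙` means that `𝔙` refines `𝔘`. -/
instance : Preorder (PointedCover X) where
  le 𝔘 𝔙 := ∀ x, 𝔙.U x ≤ 𝔘.U x
  le_refl _ _ := le_rfl
  le_trans _ _ _ h h' x := (h' x).trans (h x)

instance : Nonempty (PointedCover X) := ⟨⟨fun _ => ⊤, fun _ => trivial⟩⟩

instance : IsDirectedOrder (PointedCover X) :=
  ⟨fun 𝔘 𝔙 => ⟨⟨fun x => 𝔘.U x ⊓ 𝔙.U x, fun x => ⟨𝔘.mem x, 𝔙.mem x⟩⟩,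
    fun _ => inf_le_left, fun _ => inf_le_right⟩⟩

namespace PointedCover

variable (𝔘 : PointedCover X)

/-- The intersections `U_{ab}`, `U_{abc}`, `U_{abcd}`. -/
def U₂ (a b : X) : TopologicalSpace.Opens X := 𝔘.U a ⊓ 𝔘.U b

def U₃ (a b c : X) : TopologicalSpace.Opens X := 𝔘.U a ⊓ 𝔘.U b ⊓ 𝔘.U c

def U₄ (a b c d : X) : TopologicalSpace.Opens X := 𝔘.U a ⊓ 𝔘.U b ⊓ 𝔘.U c ⊓ 𝔘.U d

theorem le₂₀ (a b : X) : 𝔘.U₂ a b ≤ 𝔘.U a := fun _ h => h.1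
theorem le₂₁ (a b : X) : 𝔘.U₂ a b ≤ 𝔘.U b := fun _ h => h.2
theorem le₃₀ (a b c : X) : 𝔘.U₃ a b c ≤ 𝔘.U₂ b c := fun _ h => ⟨h.1.2, h.2⟩
theorem le₃₁ (a b c : X) : 𝔘.U₃ a b c ≤ 𝔘.U₂ a c := fun _ h => ⟨h.1.1, h.2⟩
theorem le₃₂ (a b c : X) : 𝔘.U₃ a b c ≤ 𝔘.U₂ a b := fun _ h => h.1
theorem le₄₀ (a b c d : X) : 𝔘.U₄ a b c d ≤ 𝔘.U₃ b c d := fun _ h => ⟨⟨h.1.1.2, h.1.2⟩, h.2⟩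
theorem le₄₁ (a b c d : X) : 𝔘.U₄ a b c d ≤ 𝔘.U₃ a c d := fun _ h => ⟨⟨h.1.1.1, h.1.2⟩, h.2⟩
theorem le₄₂ (a b c d : X) : 𝔘.U₄ a b c d ≤ 𝔘.U₃ a b d := fun _ h => ⟨h.1.1, h.2⟩
theorem le₄₃ (a b c d : X) : 𝔘.U₄ a b c d ≤ 𝔘.U₃ a b c := fun _ h => h.1

variable {𝔘} {𝔙 : PointedCover X}

theorem U₂_anti (h : 𝔘 ≤ 𝔙) (a b : X) : 𝔙.U₂ a b ≤ 𝔘.U₂ a b := inf_le_inf (h a) (h b)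
theorem U₃_anti (h : 𝔘 ≤ 𝔙) (a b c : X) : 𝔙.U₃ a b c ≤ 𝔘.U₃ a b c :=
  inf_le_inf (U₂_anti h a b) (h c)
theorem U₄_anti (h : 𝔘 ≤ 𝔙) (a b c d : X) : 𝔙.U₄ a b c d ≤ 𝔘.U₄ a b c d :=
  inf_le_inf (U₃_anti h a b c) (h d)

end PointedCover

variable {V : X → Type*} [∀ x, AddCommGroup (V x)] (F : SectionPresheaf V) (𝔘 : PointedCover X)

/-- Cech cochains of degree 0, 1, 2, 3 with values in `F`. -/
abbrev Cech0 : Type _ := ∀ a : X, F.sec (𝔘.U a)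
abbrev Cech1 : Type _ := ∀ a b : X, F.sec (𝔘.U₂ a b)
abbrev Cech2 : Type _ := ∀ a b c : X, F.sec (𝔘.U₃ a b c)
abbrev Cech3 : Type _ := ∀ a b c d : X, F.sec (𝔘.U₄ a b c d)

/-- The Cech coboundary operator in degrees 0, 1, 2. -/
noncomputable def delta0 : Cech0 F 𝔘 →+ Cech1 F 𝔘 where
  toFun s a b := F.restr (𝔘.le₂₁ a b) (s b) - F.restr (𝔘.le₂₀ a b) (s a)
  map_zero' := by ext; simp
  map_add' s t := by
    funext a b
    simp only [Pi.add_apply, map_add]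
    abel

noncomputable def delta1 : Cech1 F 𝔘 →+ Cech2 F 𝔘 where
  toFun s a b c := F.restr (𝔘.le₃₀ a b c) (s b c) - F.restr (𝔘.le₃₁ a b c) (s a c)
    + F.restr (𝔘.le₃₂ a b c) (s a b)
  map_zero' := by ext; simp
  map_add' s t := by
    funext a b c
    simp only [Pi.add_apply, map_add]
    abel

noncomputable def delta2 : Cech2 F 𝔘 →+ Cech3 F 𝔘 where
  toFun s a b c d := F.restr (𝔘.le₄₀ a b c d) (s b c d) - F.restr (𝔘.le₄₁ a b c d) (s a c d)
    + F.restr (𝔘.le₄₂ a b c d) (s a b d) - F.restr (𝔘.le₄₃ a b c d) (s a b c)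
  map_zero' := by ext; simp
  map_add' s t := by
    funext a b c d
    simp only [Pi.add_apply, map_add]
    abel

variable {F 𝔘}

theorem delta0_apply (s : Cech0 F 𝔘) (a b : X) {x : X} (hx : x ∈ 𝔘.U₂ a b) :
    (delta0 F 𝔘 s a b).1 x = (s b).1 x - (s a).1 x := by
  simp [delta0, F.restr_apply _ _ hx]

theorem delta1_apply (s : Cech1 F 𝔘) (a b c : X) {x : X} (hx : x ∈ 𝔘.U₃ a b c) :
    (delta1 F 𝔘 s a b c).1 x = (s b c).1 x - (s a c).1 x + (s a b).1 x := by
  simp [delta1, F.restr_apply _ _ hx]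

theorem delta2_apply (s : Cech2 F 𝔘) (a b c d : X) {x : X} (hx : x ∈ 𝔘.U₄ a b c d) :
    (delta2 F 𝔘 s a b c d).1 x =
      (s b c d).1 x - (s a c d).1 x + (s a b d).1 x - (s a b c).1 x := by
  simp [delta2, F.restr_apply _ _ hx]

end Covers

section Sheaves

variable {E : Type*} [NormedAddCommGroup E] [NormedSpace ℝ E] {H : Type*} [TopologicalSpace H]
  (I : ModelWithCorners ℝ E H) (X : Type*) [TopologicalSpace X] [ChartedSpace H X]

/-- The constant sheaf `ℤ`: locally constant integer-valued functions. -/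
noncomputable def sheafZ : SectionPresheaf (fun _ : X => ℤ) where
  sec W :=
    { carrier := {n | ContinuousOn n W ∧ ∀ x ∉ W, n x = 0}
      zero_mem' := ⟨continuousOn_const, fun _ _ => rfl⟩
      add_mem' := fun hf hg => ⟨hf.1.add hg.1, fun x hx => by simp [hf.2 x hx, hg.2 x hx]⟩
      neg_mem' := fun hf => ⟨hf.1.neg, fun x hx => by simp [hf.2 x hx]⟩ }
  zero_off hf := hf.2
  res_mem h _ hf := ⟨(hf.1.mono h).congr fun _ hx => res_apply _ hx,
    fun _ hx => res_apply_of_notMem _ hx⟩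

/-- The sheaf of smooth real functions. -/
noncomputable def sheafA0 : SectionPresheaf (fun _ : X => ℝ) where
  sec W :=
    { carrier := {f | ContMDiffOn I 𝓘(ℝ, ℝ) ∞ f W ∧ ∀ x ∉ W, f x = 0}
      zero_mem' := ⟨contMDiffOn_const, fun _ _ => rfl⟩
      add_mem' := fun hf hg => ⟨hf.1.add hg.1, fun x hx => by simp [hf.2 x hx, hg.2 x hx]⟩
      neg_mem' := fun hf => ⟨hf.1.neg, fun x hx => by simp [hf.2 x hx]⟩ }
  zero_off hf := hf.2
  res_mem h _ hf := ⟨(hf.1.mono h).congr fun _ hx => res_apply _ hx,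
    fun _ hx => res_apply_of_notMem _ hx⟩

variable {I X}

/-- The inclusion `ℤ → A⁰`. -/
noncomputable def incl (W : TopologicalSpace.Opens X) :
    (sheafZ X).sec W →+ (sheafA0 I X).sec W where
  toFun n := ⟨fun x => (n.1 x : ℝ), by
    refine ⟨fun x hx => ?_, fun x hx => by simp [n.2.2 x hx]⟩
    have h1 : ∀ᶠ y in nhdsWithin x W, n.1 y = n.1 x := (n.2.1 x hx).eventually_mem
      ((isOpen_discrete {n.1 x}).mem_nhds rfl)
    exact (contMDiffWithinAt_const (c := (n.1 x : ℝ))).congr_of_eventuallyEq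
      (h1.mono fun y hy => by simp [hy]) rfl⟩
  map_zero' := by ext x; simp
  map_add' n m := by ext x; simp

theorem incl_restr {W W' : TopologicalSpace.Opens X} (h : W' ≤ W) (n : (sheafZ X).sec W) :
    incl (I := I) W' ((sheafZ X).restr h n) = (sheafA0 I X).restr h (incl W n) :=
  SectionPresheaf.sec_ext fun x hx => by
    rw [SectionPresheaf.restr_apply _ _ _ hx]
    exact congrArg (fun n : ℤ => (n : ℝ)) (SectionPresheaf.restr_apply _ _ _ hx)

theorem mdifferentiableAt_of_sec {W : TopologicalSpace.Opens X} (f : (sheafA0 I X).sec W) {x : X}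
    (hx : x ∈ W) : MDifferentiableAt I 𝓘(ℝ, ℝ) f.1 x :=
  ((f.2.1 x hx).contMDiffAt (W.isOpen.mem_nhds hx)).mdifferentiableAt (by simp)

variable (I X) [IsManifold I ∞ X]

/-- The sheaf of smooth real differential 1-forms: smooth sections of the cotangent bundle. -/
noncomputable def sheafA1 : SectionPresheaf (fun x : X => TangentSpace I x →L[ℝ] ℝ) where
  sec W :=
    { carrier := {η | ContMDiffOn I (I.prod 𝓘(ℝ, E →L[ℝ] ℝ)) ∞
          (fun x => Bundle.TotalSpace.mk' (E →L[ℝ] ℝ)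
            (E := fun x : X => TangentSpace I x →L[ℝ] Bundle.Trivial X ℝ x) x (η x)) W ∧ ∀ x ∉ W, η x = 0}
      zero_mem' := ⟨(Bundle.contMDiff_zeroSection ℝ (fun x : X => TangentSpace I x →L[ℝ] Bundle.Trivial X ℝ x)).contMDiffOn, fun _ _ => rfl⟩
      add_mem' := fun hf hg => ⟨hf.1.add_section hg.1, fun x hx => by simp [hf.2 x hx, hg.2 x hx]⟩
      neg_mem' := fun hf => ⟨hf.1.neg_section, fun x hx => by simp [hf.2 x hx]⟩ }
  zero_off hf := hf.2
  res_mem h _ hf := ⟨(hf.1.mono h).congr fun _ hx => by rw [res_apply _ hx],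
    fun _ hx => res_apply_of_notMem _ hx⟩

variable {I X}

theorem contMDiffOn_mvfderiv {f : X → ℝ} {W : Set X} (hW : IsOpen W)
    (hf : ContMDiffOn I 𝓘(ℝ, ℝ) ∞ f W) :
    ContMDiffOn I (I.prod 𝓘(ℝ, E →L[ℝ] ℝ)) ∞
      (fun x => Bundle.TotalSpace.mk' (E →L[ℝ] ℝ)
        (E := fun x : X => TangentSpace I x →L[ℝ] Bundle.Trivial X ℝ x) x (mvfderiv I f x)) W := by
  intro x hx
  apply ContMDiffAt.contMDiffWithinAt
  rw [contMDiffAt_hom_bundle]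
  refine ⟨contMDiffAt_id, ?_⟩
  have := ((hf x hx).contMDiffAt (hW.mem_nhds hx)).mfderiv_const (m := ∞) le_rfl
  refine this.congr_of_eventuallyEq (Filter.Eventually.of_forall fun y => ?_)
  have h2 : (trivializationAt ℝ (TangentSpace 𝓘(ℝ, ℝ)) (f x)).continuousLinearMapAt ℝ (f y) =
      (NormedSpace.fromTangentSpace (f y)).toContinuousLinearMap := by
    ext
    simp
    rfl
  simp only [inTangentCoordinates, ContinuousLinearMap.inCoordinates, h2]
  ext v
  simp [mvfderiv]

theorem res_mvfderiv_mem {W : TopologicalSpace.Opens X} (f : (sheafA0 I X).sec W) :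
    res W (fun x => mvfderiv I f.1 x) ∈ (sheafA1 I X).sec W :=
  ⟨(contMDiffOn_mvfderiv W.isOpen f.2.1).congr fun x hx => by rw [res_apply _ hx],
    fun _ hx => res_apply_of_notMem _ hx⟩

/-- The exterior derivative `A⁰ → A¹`. -/
noncomputable def extd (W : TopologicalSpace.Opens X) :
    (sheafA0 I X).sec W →+ (sheafA1 I X).sec W where
  toFun f := ⟨res W (fun x => mvfderiv I f.1 x), res_mvfderiv_mem f⟩
  map_zero' := SectionPresheaf.sec_ext fun x hx => (res_apply _ hx).trans mvfderiv_zero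
  map_add' f g := SectionPresheaf.sec_ext fun x hx => by
    refine (res_apply _ hx).trans ((mvfderiv_add (mdifferentiableAt_of_sec f hx)
      (mdifferentiableAt_of_sec g hx)).trans ?_)
    exact congrArg₂ (· + ·) (res_apply _ hx).symm (res_apply _ hx).symm

theorem extd_apply {W : TopologicalSpace.Opens X} (f : (sheafA0 I X).sec W) {x : X} (hx : x ∈ W) :
    (extd W f).1 x = mvfderiv I f.1 x :=
  res_apply (V := fun x : X => TangentSpace I x →L[ℝ] ℝ) (fun x => mvfderiv I f.1 x) hx

theorem extd_restr {W W' : TopologicalSpace.Opens X} (h : W' ≤ W) (f : (sheafA0 I X).sec W) :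
    extd W' ((sheafA0 I X).restr h f) = (sheafA1 I X).restr h (extd W f) :=
  SectionPresheaf.sec_ext fun x hx => by
    rw [extd_apply _ hx, SectionPresheaf.restr_apply _ _ _ hx, extd_apply _ (h hx)]
    have : ((sheafA0 I X).restr h f).1 =ᶠ[nhds x] f.1 :=
      Filter.mem_of_superset (W'.isOpen.mem_nhds hx) fun y hy =>
        SectionPresheaf.restr_apply _ _ _ hy
    simp only [mvfderiv]
    rw [this.mfderiv_eq, this.eq_of_nhds]

/-- The differential of a locally constant function vanishes. -/
theorem extd_incl (W : TopologicalSpace.Opens X) (n : (sheafZ X).sec W) :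
    extd W (incl (I := I) W n) = 0 :=
  SectionPresheaf.sec_ext fun x hx => by
    rw [extd_apply _ hx]
    have h1 : ∀ᶠ y in nhds x, n.1 y = n.1 x :=
      ((n.2.1 x hx).continuousAt (W.isOpen.mem_nhds hx)).eventually_mem
        ((isOpen_discrete {n.1 x}).mem_nhds rfl)
    have : (incl (I := I) W n).1 =ᶠ[nhds x] fun _ => (n.1 x : ℝ) :=
      h1.mono fun y hy => congrArg (fun n : ℤ => (n : ℝ)) hy
    have h0 : mfderiv I 𝓘(ℝ, ℝ) (incl (I := I) W n).1 x = 0 := by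
      rw [this.mfderiv_eq]; exact mfderiv_const
    simp only [mvfderiv, h0]
    rfl

end Sheaves

section Cohomology

/-- The cohomology `ker d' / im d` of `A → B → C` at `B`. -/
def Cohomology {A B C : Type*} [AddCommGroup A] [AddCommGroup B] [AddCommGroup C]
    (d : A →+ B) (d' : B →+ C) : Type _ :=
  d'.ker ⧸ d.range.addSubgroupOf d'.ker

instance {A B C : Type*} [AddCommGroup A] [AddCommGroup B] [AddCommGroup C]
    (d : A →+ B) (d' : B →+ C) : AddCommGroup (Cohomology d d') :=
  inferInstanceAs (AddCommGroup (d'.ker ⧸ d.range.addSubgroupOf d'.ker))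

variable {A B C A' B' C' : Type*} [AddCommGroup A] [AddCommGroup B] [AddCommGroup C]
  [AddCommGroup A'] [AddCommGroup B'] [AddCommGroup C']
  {d : A →+ B} {d' : B →+ C} {e : A' →+ B'} {e' : B' →+ C'}

/-- The class of a cocycle. -/
def Cohomology.mk (d : A →+ B) (d' : B →+ C) : d'.ker →+ Cohomology d d' :=
  QuotientAddGroup.mk' (d.range.addSubgroupOf d'.ker)

theorem Cohomology.induction {P : Cohomology d d' → Prop} (h : ∀ z, P (Cohomology.mk d d' z))
    (x : Cohomology d d') : P x :=
  QuotientAddGroup.induction_on (C := P) x h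

theorem Cohomology.mk_eq_zero {z : d'.ker} (h : ∃ a, d a = z.1) : Cohomology.mk d d' z = 0 := by
  obtain ⟨a, ha⟩ := h
  exact (QuotientAddGroup.eq_zero_iff _).2 (AddSubgroup.mem_addSubgroupOf.2 ⟨a, ha⟩)

/-- A homomorphism on cocycles which vanishes on coboundaries. -/
def Cohomology.lift {G : Type*} [AddCommGroup G] (φ : d'.ker →+ G)
    (h : ∀ z : d'.ker, (∃ a, d a = z.1) → φ z = 0) : Cohomology d d' →+ G :=
  QuotientAddGroup.lift (d.range.addSubgroupOf d'.ker) φ fun z hz => h z (AddSubgroup.mem_addSubgroupOf.1 hz)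

/-- The map on cohomology induced by a map of complexes. -/
def Cohomology.map (f : A →+ A') (g : B →+ B') (h : C →+ C')
    (hfg : ∀ a, g (d a) = e (f a)) (hgh : ∀ b, h (d' b) = e' (g b)) :
    Cohomology d d' →+ Cohomology e e' :=
  Cohomology.lift
    ((Cohomology.mk e e').comp ((g.comp d'.ker.subtype).codRestrict e'.ker fun z => by
      have hz : d' z.1 = 0 := z.2
      change e' (g z.1) = 0
      rw [← hgh, hz, map_zero]))
    fun z ⟨a, ha⟩ => Cohomology.mk_eq_zero ⟨f a, by
      rw [← hfg, ha]
      rfl⟩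

end Cohomology

section Deligne

variable {E : Type*} [NormedAddCommGroup E] [NormedSpace ℝ E] {H : Type*} [TopologicalSpace H]
  (I : ModelWithCorners ℝ E H) {X : Type*} [TopologicalSpace X] [ChartedSpace H X]

/-- The total complex of the Cech double complex of the smooth Deligne complex
`ℤ(1) : ℤ → A⁰`, in degrees 0, 1, 2, with the total differential `δ + (-1)^i d` in Cech degree
`i`. In degrees 0 and 1 the groups for `ℤ(2) : ℤ → A⁰ → A¹` are the same. -/
abbrev C0 (𝔘 : PointedCover X) : Type _ := Cech0 (sheafZ X) 𝔘

/-- Degree 1: pairs `(k_{ab}, τ_a)`. -/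
abbrev C1 (𝔘 : PointedCover X) : Type _ := Cech1 (sheafZ X) 𝔘 × Cech0 (sheafA0 I X) 𝔘

/-- Degree 2 for `ℤ(1)`. -/
abbrev C2one (𝔘 : PointedCover X) : Type _ := Cech2 (sheafZ X) 𝔘 × Cech1 (sheafA0 I X) 𝔘

/-- `D n = (δ n, n)`. -/
noncomputable def D0 (𝔘 : PointedCover X) : C0 𝔘 →+ C1 I 𝔘 where
  toFun n := (delta0 _ 𝔘 n, fun a => incl _ (n a))
  map_zero' := by ext <;> simp
  map_add' n m := by ext <;> simp

/-- `D (k, τ) = (δ k, δ τ - k)` for `ℤ(1)`. -/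
noncomputable def D1one (𝔘 : PointedCover X) : C1 I 𝔘 →+ C2one I 𝔘 where
  toFun s := (delta1 _ 𝔘 s.1, fun a b => delta0 _ 𝔘 s.2 a b - incl _ (s.1 a b))
  map_zero' := by ext <;> simp
  map_add' s t := by
    refine Prod.ext (map_add _ _ _) ?_
    funext a b
    simp only [Prod.fst_add, Prod.snd_add, Pi.add_apply, map_add]
    abel

/-- `Ȟ¹(𝔘, ℤ(1))`. -/
def CechH1 (𝔘 : PointedCover X) : Type _ := Cohomology (D0 I 𝔘) (D1one I 𝔘)

noncomputable instance (𝔘 : PointedCover X) : AddCommGroup (CechH1 I 𝔘) :=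
  inferInstanceAs (AddCommGroup (Cohomology (D0 I 𝔘) (D1one I 𝔘)))

variable [IsManifold I ∞ X]

/-- Degree 2 for `ℤ(2)`: triples `(n_{abc}, ω⁰_{ab}, ω¹_a)`. -/
abbrev C2 (𝔘 : PointedCover X) : Type _ :=
  Cech2 (sheafZ X) 𝔘 × Cech1 (sheafA0 I X) 𝔘 × Cech0 (sheafA1 I X) 𝔘

/-- Degree 3 for `ℤ(2)`. -/
abbrev C3 (𝔘 : PointedCover X) : Type _ :=
  Cech3 (sheafZ X) 𝔘 × Cech2 (sheafA0 I X) 𝔘 × Cech1 (sheafA1 I X) 𝔘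

/-- `D (k, τ) = (δ k, δ τ - k, d τ)` for `ℤ(2)`. -/
noncomputable def D1 (𝔘 : PointedCover X) : C1 I 𝔘 →+ C2 I 𝔘 where
  toFun s := (delta1 _ 𝔘 s.1, fun a b => delta0 _ 𝔘 s.2 a b - incl _ (s.1 a b),
    fun a => extd _ (s.2 a))
  map_zero' := by
    refine Prod.ext (map_zero _) (Prod.ext ?_ ?_)
    · funext a b; simp
    · funext a; exact map_zero _
  map_add' s t := by
    refine Prod.ext (map_add _ _ _) (Prod.ext ?_ ?_)
    · funext a b
      simp only [Prod.fst_add, Prod.snd_add, Pi.add_apply, map_add]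
      abel
    · funext a; exact map_add _ _ _

/-- `D (n, ω⁰, ω¹) = (δ n, δ ω⁰ + n, δ ω¹ - d ω⁰)` for `ℤ(2)`. -/
noncomputable def D2 (𝔘 : PointedCover X) : C2 I 𝔘 →+ C3 I 𝔘 where
  toFun s := (delta2 _ 𝔘 s.1, fun a b c => delta1 _ 𝔘 s.2.1 a b c + incl _ (s.1 a b c),
    fun a b => delta0 _ 𝔘 s.2.2 a b - extd _ (s.2.1 a b))
  map_zero' := by
    refine Prod.ext (map_zero _) (Prod.ext ?_ ?_)
    · funext a b c; simp
    · funext a b; simp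
  map_add' s t := by
    refine Prod.ext (map_add _ _ _) (Prod.ext ?_ ?_)
    · funext a b c
      simp only [Prod.fst_add, Prod.snd_add, Pi.add_apply, map_add]
      abel
    · funext a b
      simp only [Prod.snd_add, Prod.fst_add, Pi.add_apply, map_add]
      abel

/-- `Ȟ²(𝔘, ℤ(2))`. -/
def CechH2 (𝔘 : PointedCover X) : Type _ := Cohomology (D1 I 𝔘) (D2 I 𝔘)

noncomputable instance (𝔘 : PointedCover X) : AddCommGroup (CechH2 I 𝔘) :=
  inferInstanceAs (AddCommGroup (Cohomology (D1 I 𝔘) (D2 I 𝔘)))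

end Deligne

section Refinement

variable {X : Type*} [TopologicalSpace X] {V : X → Type*} [∀ x, AddCommGroup (V x)]
  (F : SectionPresheaf V) {𝔘 𝔙 : PointedCover X}

theorem SectionPresheaf.restr_self {W : TopologicalSpace.Opens X} (h : W ≤ W) (f : F.sec W) :
    F.restr h f = f := sec_ext fun _ hx => F.restr_apply _ _ hx

theorem SectionPresheaf.restr_restr {W W' W'' : TopologicalSpace.Opens X} (h : W' ≤ W)
    (h' : W'' ≤ W') (f : F.sec W) : F.restr h' (F.restr h f) = F.restr (h'.trans h) f :=
  sec_ext fun _ hx => by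
    rw [F.restr_apply _ _ hx, F.restr_apply _ _ (h' hx), F.restr_apply _ _ hx]

/-- Restriction of Cech cochains to a finer cover. -/
noncomputable def ref0 (h : 𝔘 ≤ 𝔙) : Cech0 F 𝔘 →+ Cech0 F 𝔙 where
  toFun s a := F.restr (h a) (s a)
  map_zero' := by ext; simp
  map_add' s t := by funext a; simp

noncomputable def ref1 (h : 𝔘 ≤ 𝔙) : Cech1 F 𝔘 →+ Cech1 F 𝔙 where
  toFun s a b := F.restr (PointedCover.U₂_anti h a b) (s a b)
  map_zero' := by ext; simp
  map_add' s t := by funext a b; simp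

noncomputable def ref2 (h : 𝔘 ≤ 𝔙) : Cech2 F 𝔘 →+ Cech2 F 𝔙 where
  toFun s a b c := F.restr (PointedCover.U₃_anti h a b c) (s a b c)
  map_zero' := by ext; simp
  map_add' s t := by funext a b c; simp

noncomputable def ref3 (h : 𝔘 ≤ 𝔙) : Cech3 F 𝔘 →+ Cech3 F 𝔙 where
  toFun s a b c d := F.restr (PointedCover.U₄_anti h a b c d) (s a b c d)
  map_zero' := by ext; simp
  map_add' s t := by funext a b c d; simp

theorem ref0_delta0 (h : 𝔘 ≤ 𝔙) (s : Cech0 F 𝔘) :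
    ref1 F h (delta0 F 𝔘 s) = delta0 F 𝔙 (ref0 F h s) := by
  funext a b
  simp [ref1, ref0, delta0, F.restr_restr]

theorem ref1_delta1 (h : 𝔘 ≤ 𝔙) (s : Cech1 F 𝔘) :
    ref2 F h (delta1 F 𝔘 s) = delta1 F 𝔙 (ref1 F h s) := by
  funext a b c
  simp [ref2, ref1, delta1, F.restr_restr]

theorem ref2_delta2 (h : 𝔘 ≤ 𝔙) (s : Cech2 F 𝔘) :
    ref3 F h (delta2 F 𝔘 s) = delta2 F 𝔙 (ref2 F h s) := by
  funext a b c d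
  simp [ref3, ref2, delta2, F.restr_restr]

end Refinement

section Limit

variable {E : Type*} [NormedAddCommGroup E] [NormedSpace ℝ E] {H : Type*} [TopologicalSpace H]
  (I : ModelWithCorners ℝ E H) (X : Type*) [TopologicalSpace X] [ChartedSpace H X]

/-- The refinement map `Ȟ¹(𝔘, ℤ(1)) → Ȟ¹(𝔙, ℤ(1))`. -/
noncomputable def refH1 (𝔘 𝔙 : PointedCover X) (h : 𝔘 ≤ 𝔙) : CechH1 I 𝔘 →+ CechH1 I 𝔙 :=
  Cohomology.map (ref0 _ h) ((ref1 _ h).prodMap (ref0 _ h)) ((ref2 _ h).prodMap (ref1 _ h))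
    (fun n => by
      refine Prod.ext (ref0_delta0 _ h n) ?_
      funext a
      simp [D0, ref0, incl_restr])
    (fun s => by
      refine Prod.ext (ref1_delta1 _ h s.1) ?_
      funext a b
      have := congrFun (congrFun (ref0_delta0 _ h s.2) a) b
      simp only [D1one, AddMonoidHom.coe_mk, ZeroHom.coe_mk, AddMonoidHom.coe_prodMap,
        Prod.map_snd, Prod.map_fst]
      rw [← this]
      simp [ref1, incl_restr])

instance : DirectedSystem (fun 𝔘 : PointedCover X => CechH1 I 𝔘) (fun 𝔘 𝔙 h => refH1 I X 𝔘 𝔙 h) where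
  map_self 𝔘 x := by
    induction x using Cohomology.induction with | _ z =>
    refine congrArg (Cohomology.mk _ _) (Subtype.ext (Prod.ext ?_ ?_))
    · funext a b; exact SectionPresheaf.restr_self _ le_rfl _
    · funext a; exact SectionPresheaf.restr_self _ le_rfl _
  map_map 𝔚 𝔙 𝔘 h h' x := by
    induction x using Cohomology.induction with | _ z =>
    refine congrArg (Cohomology.mk _ _) (Subtype.ext (Prod.ext ?_ ?_))
    · funext a b; exact SectionPresheaf.restr_restr _ (PointedCover.U₂_anti h a b)
        (PointedCover.U₂_anti h' a b) _
    · funext a; exact SectionPresheaf.restr_restr _ (h a) (h' a) _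

/-- The smooth Deligne cohomology group `H¹(X, ℤ(1))`, the direct limit of the Cech groups over
all open covers. -/
def DeligneH1 : Type _ :=
  DirectLimit (fun 𝔘 : PointedCover X => CechH1 I 𝔘) (refH1 I X)

noncomputable instance : AddCommGroup (DeligneH1 I X) :=
  inferInstanceAs (AddCommGroup (DirectLimit (fun 𝔘 : PointedCover X => CechH1 I 𝔘) (refH1 I X)))

variable {X} in
/-- The class in `H¹(X, ℤ(1))` of a Cech class for the cover `𝔘`. -/
noncomputable def DeligneH1.mk (𝔘 : PointedCover X) : CechH1 I 𝔘 →+ DeligneH1 I X :=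
  AddMonoidHom.mk' (fun x => (⟦⟨𝔘, x⟩⟧ : DirectLimit _ (refH1 I X)))
    fun _ _ => (DirectLimit.add_def 𝔘 _ _).symm

variable {X} in
theorem DeligneH1.exists_mk₃ (x y z : DeligneH1 I X) : ∃ (𝔘 : PointedCover X) (f g h : CechH1 I 𝔘),
    x = DeligneH1.mk I 𝔘 f ∧ y = DeligneH1.mk I 𝔘 g ∧ z = DeligneH1.mk I 𝔘 h :=
  DirectLimit.exists_eq_mk₃ (refH1 I X) x y z

variable [IsManifold I ∞ X]

/-- The refinement map `Ȟ²(𝔘, ℤ(2)) → Ȟ²(𝔙, ℤ(2))`. -/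
noncomputable def refH2 (𝔘 𝔙 : PointedCover X) (h : 𝔘 ≤ 𝔙) : CechH2 I 𝔘 →+ CechH2 I 𝔙 :=
  Cohomology.map ((ref1 _ h).prodMap (ref0 _ h))
    ((ref2 _ h).prodMap ((ref1 _ h).prodMap (ref0 _ h)))
    ((ref3 _ h).prodMap ((ref2 _ h).prodMap (ref1 _ h)))
    (fun s => by
      refine Prod.ext (ref1_delta1 _ h s.1) (Prod.ext ?_ ?_)
      · funext a b
        have := congrFun (congrFun (ref0_delta0 _ h s.2) a) b
        simp only [D1, AddMonoidHom.coe_mk, ZeroHom.coe_mk, AddMonoidHom.coe_prodMap,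
          Prod.map_snd, Prod.map_fst]
        rw [← this]
        simp [ref1, incl_restr]
      · funext a
        exact (extd_restr (h a) _).symm)
    (fun s => by
      refine Prod.ext (ref2_delta2 _ h s.1) (Prod.ext ?_ ?_)
      · funext a b c
        have := congrFun (congrFun (congrFun (ref1_delta1 _ h s.2.1) a) b) c
        simp only [D2, AddMonoidHom.coe_mk, ZeroHom.coe_mk, AddMonoidHom.coe_prodMap,
          Prod.map_snd, Prod.map_fst]
        rw [← this]
        simp [ref2, incl_restr]
      · funext a b
        have := congrFun (congrFun (ref0_delta0 _ h s.2.2) a) b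
        simp only [D2, AddMonoidHom.coe_mk, ZeroHom.coe_mk, AddMonoidHom.coe_prodMap,
          Prod.map_snd, Prod.map_fst]
        rw [← this]
        simp [ref1, extd_restr])

instance : DirectedSystem (fun 𝔘 : PointedCover X => CechH2 I 𝔘) (fun 𝔘 𝔙 h => refH2 I X 𝔘 𝔙 h) where
  map_self 𝔘 x := by
    induction x using Cohomology.induction with | _ z =>
    refine congrArg (Cohomology.mk _ _) (Subtype.ext (Prod.ext ?_ (Prod.ext ?_ ?_)))
    · funext a b c; exact SectionPresheaf.restr_self _ le_rfl _
    · funext a b; exact SectionPresheaf.restr_self _ le_rfl _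
    · funext a; exact SectionPresheaf.restr_self _ le_rfl _
  map_map 𝔚 𝔙 𝔘 h h' x := by
    induction x using Cohomology.induction with | _ z =>
    refine congrArg (Cohomology.mk _ _) (Subtype.ext (Prod.ext ?_ (Prod.ext ?_ ?_)))
    · funext a b c; exact SectionPresheaf.restr_restr _ (PointedCover.U₃_anti h a b c)
        (PointedCover.U₃_anti h' a b c) _
    · funext a b; exact SectionPresheaf.restr_restr _ (PointedCover.U₂_anti h a b)
        (PointedCover.U₂_anti h' a b) _
    · funext a; exact SectionPresheaf.restr_restr _ (h a) (h' a) _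

/-- The smooth Deligne cohomology group `H²(X, ℤ(2))`. -/
def DeligneH2 : Type _ :=
  DirectLimit (fun 𝔘 : PointedCover X => CechH2 I 𝔘) (refH2 I X)

noncomputable instance : AddCommGroup (DeligneH2 I X) :=
  inferInstanceAs (AddCommGroup (DirectLimit (fun 𝔘 : PointedCover X => CechH2 I 𝔘) (refH2 I X)))

variable {X} in
/-- The class in `H²(X, ℤ(2))` of a Cech class for the cover `𝔘`. -/
noncomputable def DeligneH2.mk (𝔘 : PointedCover X) : CechH2 I 𝔘 →+ DeligneH2 I X :=
  AddMonoidHom.mk' (fun x => (⟦⟨𝔘, x⟩⟧ : DirectLimit _ (refH2 I X)))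
    fun _ _ => (DirectLimit.add_def 𝔘 _ _).symm

variable {X} in
theorem DeligneH2.exists_mk₃ (x y z : DeligneH2 I X) : ∃ (𝔘 : PointedCover X) (f g h : CechH2 I 𝔘),
    x = DeligneH2.mk I 𝔘 f ∧ y = DeligneH2.mk I 𝔘 g ∧ z = DeligneH2.mk I 𝔘 h :=
  DirectLimit.exists_eq_mk₃ (refH2 I X) x y z

end Limit

section Products

variable {E : Type*} [NormedAddCommGroup E] [NormedSpace ℝ E] {H : Type*} [TopologicalSpace H]
  {I : ModelWithCorners ℝ E H} {X : Type*} [TopologicalSpace X] [ChartedSpace H X]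
  {W : TopologicalSpace.Opens X}

/-- Products of sections. -/
noncomputable def mulZZ (k m : (sheafZ X).sec W) : (sheafZ X).sec W :=
  ⟨fun x => k.1 x * m.1 x, k.2.1.mul m.2.1, fun x hx => by simp [k.2.2 x hx]⟩

noncomputable def mulZA (k : (sheafZ X).sec W) (f : (sheafA0 I X).sec W) : (sheafA0 I X).sec W :=
  ⟨fun x => k.1 x * f.1 x, (incl (I := I) W k).2.1.mul f.2.1, fun x hx => by simp [k.2.2 x hx]⟩

variable [IsManifold I ∞ X]

/-- The wedge product of a function and a 1-form. -/
noncomputable def wedge (f : (sheafA0 I X).sec W) (η : (sheafA1 I X).sec W) :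
    (sheafA1 I X).sec W :=
  ⟨fun x => f.1 x • η.1 x, f.2.1.smul_section η.2.1, fun x hx => by simp [f.2.2 x hx]⟩

theorem extd_mulZA (k : (sheafZ X).sec W) (f : (sheafA0 I X).sec W) :
    extd W (mulZA k f) = wedge (incl W k) (extd W f) :=
  SectionPresheaf.sec_ext fun x hx => by
    refine (extd_apply _ hx).trans ?_
    have h1 : ∀ᶠ y in nhds x, k.1 y = k.1 x :=
      ((k.2.1 x hx).continuousAt (W.isOpen.mem_nhds hx)).eventually_mem
        ((isOpen_discrete {k.1 x}).mem_nhds rfl)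
    have h2 : (mulZA k f).1 =ᶠ[nhds x] fun y => (k.1 x : ℝ) • f.1 y :=
      h1.mono fun y hy => by
        change (k.1 y : ℝ) * f.1 y = (k.1 x : ℝ) * f.1 y
        rw [hy]
    have h3 : mvfderiv I (mulZA k f).1 x = mvfderiv I (fun y => (k.1 x : ℝ) • f.1 y) x := by
      simp only [mvfderiv]
      rw [h2.mfderiv_eq, h2.eq_of_nhds]
    have h4 : mvfderiv I (fun y => (k.1 x : ℝ) • f.1 y) x = (k.1 x : ℝ) • mvfderiv I f.1 x := by
      refine (mvfderiv_smul (a := fun _ => (k.1 x : ℝ)) mdifferentiableAt_const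
        (mdifferentiableAt_of_sec f hx)).trans ?_
      ext v
      simp [mvfderiv_const]
    refine h3.trans (h4.trans ?_)
    exact congrArg ((k.1 x : ℝ) • ·) (extd_apply f hx).symm

end Products

section Cup

variable {E : Type*} [NormedAddCommGroup E] [NormedSpace ℝ E] {H : Type*} [TopologicalSpace H]
  {I : ModelWithCorners ℝ E H} {X : Type*} [TopologicalSpace X] [ChartedSpace H X]
  {𝔘 𝔙 : PointedCover X}

theorem one_cocycle_iff {s : C1 I 𝔘} : D1one I 𝔘 s = 0 ↔
    ∀ a b, ∀ x ∈ 𝔘.U₂ a b, (s.2 b).1 x - (s.2 a).1 x = (s.1 a b).1 x := by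
  constructor
  · intro h a b x hx
    have h1 := congrFun (congrFun (congrArg Prod.snd h) a) b
    have h2 : (delta0 _ 𝔘 s.2 a b).1 x - (incl (I := I) _ (s.1 a b)).1 x = 0 :=
      congrFun (congrArg Subtype.val h1) x
    rw [delta0_apply _ _ _ hx] at h2
    exact sub_eq_zero.1 h2
  · intro h
    refine Prod.ext ?_ ?_
    · funext a b c
      refine SectionPresheaf.sec_ext fun x hx => ?_
      have h1 := h a b x hx.1
      have h2 := h b c x ⟨hx.1.2, hx.2⟩
      have h3 := h a c x ⟨hx.1.1, hx.2⟩
      refine (delta1_apply _ _ _ _ hx).trans ?_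
      have : ((s.1 b c).1 x - (s.1 a c).1 x + (s.1 a b).1 x : ℝ) = 0 := by
        rw [← h1, ← h2, ← h3]; ring
      exact_mod_cast this
    · funext a b
      refine SectionPresheaf.sec_ext fun x hx => ?_
      refine (congrArg (· - ((s.1 a b).1 x : ℝ)) (delta0_apply _ _ _ hx)).trans ?_
      exact sub_eq_zero.2 (h a b x hx)

theorem one_cocycle_int {s : C1 I 𝔘} (h : D1one I 𝔘 s = 0) (a b c : X) {x : X}
    (hx : x ∈ 𝔘.U₃ a b c) : (s.1 b c).1 x - (s.1 a c).1 x + (s.1 a b).1 x = 0 := by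
  rw [← delta1_apply _ _ _ _ hx]
  have := congrFun (congrFun (congrFun (congrArg Prod.fst h) a) b) c
  exact congrFun (congrArg Subtype.val this) x

variable [IsManifold I ∞ X]

theorem one_cocycle_extd {s : C1 I 𝔘} (h : D1one I 𝔘 s = 0) (a b : X) {x : X}
    (hx : x ∈ 𝔘.U₂ a b) : (extd _ (s.2 b)).1 x = (extd _ (s.2 a)).1 x := by
  have h1 := congrFun (congrFun (congrArg Prod.snd h) a) b
  have h2 : delta0 _ 𝔘 s.2 a b = incl (I := I) _ (s.1 a b) := sub_eq_zero.1 h1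
  have h3 := congrArg (extd _) h2
  rw [extd_incl] at h3
  simp only [delta0, AddMonoidHom.coe_mk, ZeroHom.coe_mk, map_sub, extd_restr] at h3
  have h4 := congrFun (congrArg Subtype.val (sub_eq_zero.1 h3)) x
  rwa [SectionPresheaf.restr_apply _ _ _ hx, SectionPresheaf.restr_apply _ _ _ hx] at h4

/-- The cup product of cochains,
`(k, τ) ∪ (m, θ) = (k_{ab} m_{bc}, k_{ab} θ_b, τ_a ∧ dθ_a)`. -/
noncomputable def cupCochain (s t : C1 I 𝔘) : C2 I 𝔘 :=
  (fun a b c => mulZZ ((sheafZ X).restr (𝔘.le₃₂ a b c) (s.1 a b))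
      ((sheafZ X).restr (𝔘.le₃₀ a b c) (t.1 b c)),
    fun a b => mulZA (s.1 a b) ((sheafA0 I X).restr (𝔘.le₂₁ a b) (t.2 b)),
    fun a => wedge (s.2 a) (extd _ (t.2 a)))

theorem cupCochain_fst (s t : C1 I 𝔘) (a b c : X) {x : X} (hx : x ∈ 𝔘.U₃ a b c) :
    ((cupCochain s t).1 a b c).1 x = (s.1 a b).1 x * (t.1 b c).1 x :=
  congrArg₂ (· * ·) (SectionPresheaf.restr_apply _ _ _ hx) (SectionPresheaf.restr_apply _ _ _ hx)

theorem cupCochain_snd (s t : C1 I 𝔘) (a b : X) {x : X} (hx : x ∈ 𝔘.U₂ a b) :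
    ((cupCochain s t).2.1 a b).1 x = (s.1 a b).1 x * (t.2 b).1 x :=
  congrArg (fun y : ℝ => ((s.1 a b).1 x : ℝ) * y) (SectionPresheaf.restr_apply _ _ _ hx)

theorem cupCochain_trd (s t : C1 I 𝔘) (a : X) (x : X) :
    ((cupCochain s t).2.2 a).1 x = (s.2 a).1 x • (extd _ (t.2 a)).1 x := rfl

theorem C2_ext {s t : C2 I 𝔘}
    (h0 : ∀ a b c, ∀ x ∈ 𝔘.U₃ a b c, (s.1 a b c).1 x = (t.1 a b c).1 x)
    (h1 : ∀ a b, ∀ x ∈ 𝔘.U₂ a b, (s.2.1 a b).1 x = (t.2.1 a b).1 x)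
    (h2 : ∀ a, ∀ x ∈ 𝔘.U a, (s.2.2 a).1 x = (t.2.2 a).1 x) : s = t :=
  Prod.ext (funext fun a => funext fun b => funext fun c => SectionPresheaf.sec_ext (h0 a b c))
    (Prod.ext (funext fun a => funext fun b => SectionPresheaf.sec_ext (h1 a b))
      (funext fun a => SectionPresheaf.sec_ext (h2 a)))

theorem cupCochain_add_left (s s' t : C1 I 𝔘) :
    cupCochain (s + s') t = cupCochain s t + cupCochain s' t := by
  refine C2_ext (fun a b c x hx => ?_) (fun a b x hx => ?_) fun a x hx => ?_
  · refine (cupCochain_fst _ _ _ _ _ hx).trans ?_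
    refine Eq.trans ?_ (congrArg₂ (· + ·) (cupCochain_fst _ _ _ _ _ hx).symm
      (cupCochain_fst _ _ _ _ _ hx).symm)
    exact add_mul _ _ _
  · refine (cupCochain_snd _ _ _ _ hx).trans ?_
    refine Eq.trans ?_ (congrArg₂ (· + ·) (cupCochain_snd _ _ _ _ hx).symm
      (cupCochain_snd _ _ _ _ hx).symm)
    change (((s.1 a b).1 x + (s'.1 a b).1 x : ℤ) : ℝ) * _ = _
    push_cast
    ring
  · exact add_smul ((s.2 a).1 x) ((s'.2 a).1 x) ((extd _ (t.2 a)).1 x)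

theorem cupCochain_add_right (s t t' : C1 I 𝔘) :
    cupCochain s (t + t') = cupCochain s t + cupCochain s t' := by
  refine C2_ext (fun a b c x hx => ?_) (fun a b x hx => ?_) fun a x hx => ?_
  · refine (cupCochain_fst _ _ _ _ _ hx).trans ?_
    refine Eq.trans ?_ (congrArg₂ (· + ·) (cupCochain_fst _ _ _ _ _ hx).symm
      (cupCochain_fst _ _ _ _ _ hx).symm)
    exact mul_add _ _ _
  · refine (cupCochain_snd _ _ _ _ hx).trans ?_
    refine Eq.trans ?_ (congrArg₂ (· + ·) (cupCochain_snd _ _ _ _ hx).symm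
      (cupCochain_snd _ _ _ _ hx).symm)
    exact mul_add _ _ _
  · rw [cupCochain_trd]
    have : extd _ ((t + t').2 a) = extd _ (t.2 a) + extd _ (t'.2 a) := map_add _ _ _
    rw [this]
    exact smul_add ((s.2 a).1 x) ((extd _ (t.2 a)).1 x) ((extd _ (t'.2 a)).1 x)

theorem D2_cupCochain {s t : C1 I 𝔘} (hs : D1one I 𝔘 s = 0) (ht : D1one I 𝔘 t = 0) :
    D2 I 𝔘 (cupCochain s t) = 0 := by
  refine Prod.ext ?_ (Prod.ext ?_ ?_)
  · funext a b c d
    refine SectionPresheaf.sec_ext fun x hx => (delta2_apply _ _ _ _ _ hx).trans ?_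
    obtain ⟨⟨⟨ha, hb⟩, hc⟩, hd⟩ := hx
    rw [cupCochain_fst _ _ _ _ _ ⟨⟨hb, hc⟩, hd⟩, cupCochain_fst _ _ _ _ _ ⟨⟨ha, hc⟩, hd⟩,
      cupCochain_fst _ _ _ _ _ ⟨⟨ha, hb⟩, hd⟩, cupCochain_fst _ _ _ _ _ ⟨⟨ha, hb⟩, hc⟩]
    have h1 := one_cocycle_int hs a b c ⟨⟨ha, hb⟩, hc⟩
    have h2 := one_cocycle_int ht b c d ⟨⟨hb, hc⟩, hd⟩
    change _ = (0 : ℤ)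
    linear_combination (t.1 c d).1 x * h1 - (s.1 a b).1 x * h2
  · funext a b c
    refine SectionPresheaf.sec_ext fun x hx => ?_
    have h0 : (delta1 _ 𝔘 (cupCochain s t).2.1 a b c).1 x +
        (((cupCochain s t).1 a b c).1 x : ℝ) = 0 := by
      rw [delta1_apply _ _ _ _ hx, cupCochain_fst _ _ _ _ _ hx]
      obtain ⟨⟨ha, hb⟩, hc⟩ := hx
      rw [cupCochain_snd _ _ _ _ ⟨hb, hc⟩, cupCochain_snd _ _ _ _ ⟨ha, hc⟩,
        cupCochain_snd _ _ _ _ ⟨ha, hb⟩]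
      have h1 := one_cocycle_int hs a b c ⟨⟨ha, hb⟩, hc⟩
      have h1' : ((s.1 b c).1 x - (s.1 a c).1 x + (s.1 a b).1 x : ℝ) = 0 := by exact_mod_cast h1
      have h2 := one_cocycle_iff.1 ht b c x ⟨hb, hc⟩
      push_cast
      linear_combination (t.2 c).1 x * h1' - (s.1 a b).1 x * h2
    exact h0
  · funext a b
    refine SectionPresheaf.sec_ext fun x hx => ?_
    have h0 : (delta0 _ 𝔘 (cupCochain s t).2.2 a b).1 x
        - (extd _ ((cupCochain s t).2.1 a b)).1 x = 0 := by
      have h3 : (extd _ ((cupCochain s t).2.1 a b)).1 x =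
          ((s.1 a b).1 x : ℝ) • (extd _ (t.2 b)).1 x := by
        have : extd _ ((cupCochain s t).2.1 a b) = _ := extd_mulZA _ _
        rw [this, extd_restr]
        exact congrArg (((s.1 a b).1 x : ℝ) • ·) (SectionPresheaf.restr_apply _ _ _ hx)
      rw [delta0_apply _ _ _ hx, h3, cupCochain_trd, cupCochain_trd, one_cocycle_extd ht a b hx,
        ← one_cocycle_iff.1 hs a b x hx]
      exact sub_eq_zero.2 (sub_smul ((s.2 b).1 x) ((s.2 a).1 x)
        ((extd _ (t.2 a)).1 x : TangentSpace I x →L[ℝ] ℝ)).symm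
    exact h0

/-- A coboundary cup a cocycle is a coboundary. -/
theorem cupCochain_D0_left (n : C0 𝔘) {t : C1 I 𝔘} (ht : D1one I 𝔘 t = 0) :
    ∃ w, D1 I 𝔘 w = cupCochain (D0 I 𝔘 n) t := by
  refine ⟨(fun a b => mulZZ ((sheafZ X).restr (𝔘.le₂₀ a b) (n a)) (t.1 a b),
    fun a => mulZA (n a) (t.2 a)), C2_ext (fun a b c x hx => ?_) (fun a b x hx => ?_)
    fun a x hx => ?_⟩
  · refine (delta1_apply _ _ _ _ hx).trans ?_
    rw [cupCochain_fst _ _ _ _ _ hx]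
    have h1 := one_cocycle_int ht a b c hx
    obtain ⟨⟨ha, hb⟩, hc⟩ := hx
    have e : ((D0 I 𝔘 n).1 a b).1 x = (n b).1 x - (n a).1 x := delta0_apply _ _ _ ⟨ha, hb⟩
    rw [e]
    simp only [mulZZ]
    rw [SectionPresheaf.restr_apply _ _ _ (show x ∈ 𝔘.U₂ b c from ⟨hb, hc⟩),
      SectionPresheaf.restr_apply _ _ _ (show x ∈ 𝔘.U₂ a c from ⟨ha, hc⟩),
      SectionPresheaf.restr_apply _ _ _ (show x ∈ 𝔘.U₂ a b from ⟨ha, hb⟩)]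
    linear_combination (n a).1 x * h1
  · rw [cupCochain_snd _ _ _ _ hx]
    have e : ((D0 I 𝔘 n).1 a b).1 x = (n b).1 x - (n a).1 x := delta0_apply _ _ _ hx
    rw [e]
    have h2 := one_cocycle_iff.1 ht a b x hx
    have h0 : (delta0 (sheafA0 I X) 𝔘 (fun a => mulZA (n a) (t.2 a)) a b).1 x
        - ((mulZZ ((sheafZ X).restr (𝔘.le₂₀ a b) (n a)) (t.1 a b)).1 x : ℝ) =
        (((n b).1 x - (n a).1 x : ℤ) : ℝ) * (t.2 b).1 x := by
      rw [delta0_apply _ _ _ hx]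
      simp only [mulZZ, mulZA]
      rw [SectionPresheaf.restr_apply _ _ _ hx]
      push_cast
      linear_combination (n a).1 x * h2
    exact h0
  · exact congrFun (congrArg Subtype.val (extd_mulZA (n a) (t.2 a))) x

/-- A cocycle cup a coboundary is a coboundary. -/
theorem cupCochain_D0_right {s : C1 I 𝔘} (hs : D1one I 𝔘 s = 0) (n : C0 𝔘) :
    ∃ w, D1 I 𝔘 w = cupCochain s (D0 I 𝔘 n) := by
  refine ⟨(fun a b => -mulZZ (s.1 a b) ((sheafZ X).restr (𝔘.le₂₁ a b) (n b)), 0),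
    C2_ext (fun a b c x hx => ?_) (fun a b x hx => ?_) fun a x hx => ?_⟩
  · refine (delta1_apply _ _ _ _ hx).trans ?_
    rw [cupCochain_fst _ _ _ _ _ hx]
    have h1 := one_cocycle_int hs a b c hx
    obtain ⟨⟨ha, hb⟩, hc⟩ := hx
    have e : ((D0 I 𝔘 n).1 b c).1 x = (n c).1 x - (n b).1 x := delta0_apply _ _ _ ⟨hb, hc⟩
    rw [e]
    simp only [mulZZ, AddSubgroup.coe_neg, Pi.neg_apply]
    rw [SectionPresheaf.restr_apply _ _ _ (show x ∈ 𝔘.U₂ b c from ⟨hb, hc⟩),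
      SectionPresheaf.restr_apply _ _ _ (show x ∈ 𝔘.U₂ a c from ⟨ha, hc⟩),
      SectionPresheaf.restr_apply _ _ _ (show x ∈ 𝔘.U₂ a b from ⟨ha, hb⟩)]
    linear_combination -(n c).1 x * h1
  · rw [cupCochain_snd _ _ _ _ hx]
    have e : ((D0 I 𝔘 n).2 b).1 x = ((n b).1 x : ℝ) := rfl
    rw [e]
    have h0 : (delta0 (sheafA0 I X) 𝔘 0 a b).1 x
        - ((-((s.1 a b).1 x * ((sheafZ X).restr (𝔘.le₂₁ a b) (n b)).1 x) : ℤ) : ℝ) =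
        ((s.1 a b).1 x : ℝ) * (n b).1 x := by
      rw [delta0_apply _ _ _ hx, SectionPresheaf.restr_apply _ _ _ hx]
      simp
    exact h0
  · rw [cupCochain_trd]
    have e : extd _ ((D0 I 𝔘 n).2 a) = 0 := extd_incl _ _
    have e' : extd (I := I) (𝔘.U a) 0 = 0 := map_zero _
    rw [e]
    refine (congrFun (congrArg Subtype.val e') x).trans ?_
    exact (smul_zero _).symm

/-- The cup product of cocycles. -/
noncomputable def cupCocycle (s t : (D1one I 𝔘).ker) : (D2 I 𝔘).ker :=
  ⟨cupCochain s.1 t.1, AddMonoidHom.mem_ker.2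
    (D2_cupCochain (AddMonoidHom.mem_ker.1 s.2) (AddMonoidHom.mem_ker.1 t.2))⟩

/-- The cup product `Ȟ¹(𝔘, ℤ(1)) × Ȟ¹(𝔘, ℤ(1)) → Ȟ²(𝔘, ℤ(2))`. -/
noncomputable def cechCup (𝔘 : PointedCover X) : CechH1 I 𝔘 →+ CechH1 I 𝔘 →+ CechH2 I 𝔘 :=
  Cohomology.lift
    (AddMonoidHom.mk' (fun s => Cohomology.lift
        (AddMonoidHom.mk' (fun t => Cohomology.mk (D1 I 𝔘) (D2 I 𝔘) (cupCocycle s t))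
          fun t t' => (congrArg (Cohomology.mk (D1 I 𝔘) (D2 I 𝔘))
            (Subtype.ext (cupCochain_add_right s.1 t.1 t'.1) :
              cupCocycle s (t + t') = cupCocycle s t + cupCocycle s t')).trans (map_add _ _ _))
        fun t ⟨n, hn⟩ => Cohomology.mk_eq_zero (by
          obtain ⟨w, hw⟩ := cupCochain_D0_right (AddMonoidHom.mem_ker.1 s.2) n
          exact ⟨w, hw.trans (congrArg (cupCochain s.1) hn)⟩))
      fun s s' => AddMonoidHom.ext fun x => by
        induction x using Cohomology.induction with | _ t =>
        exact (congrArg (Cohomology.mk (D1 I 𝔘) (D2 I 𝔘))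
            (Subtype.ext (cupCochain_add_left s.1 s'.1 t.1) :
              cupCocycle (s + s') t = cupCocycle s t + cupCocycle s' t)).trans (map_add _ _ _))
    fun s ⟨n, hn⟩ => AddMonoidHom.ext fun x => by
      induction x using Cohomology.induction with | _ t =>
      refine Cohomology.mk_eq_zero ?_
      obtain ⟨w, hw⟩ := cupCochain_D0_left n (AddMonoidHom.mem_ker.1 t.2)
      exact ⟨w, hw.trans (congrArg (cupCochain · t.1) hn)⟩

theorem cupCochain_refine (h : 𝔘 ≤ 𝔙) (s t : C1 I 𝔘) :
    ((ref2 _ h).prodMap ((ref1 _ h).prodMap (ref0 _ h))) (cupCochain s t) =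
      cupCochain (((ref1 _ h).prodMap (ref0 _ h)) s) (((ref1 _ h).prodMap (ref0 _ h)) t) := by
  refine C2_ext (fun a b c x hx => ?_) (fun a b x hx => ?_) fun a x hx => ?_
  · refine Eq.trans (b := ((cupCochain s t).1 a b c).1 x)
      (SectionPresheaf.restr_apply _ (PointedCover.U₃_anti h a b c) _ hx) ?_
    rw [cupCochain_fst _ _ _ _ _ hx, cupCochain_fst _ _ _ _ _ (PointedCover.U₃_anti h a b c hx)]
    exact congrArg₂ (· * ·)
      (SectionPresheaf.restr_apply _ (PointedCover.U₂_anti h a b) _ hx.1).symm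
      (SectionPresheaf.restr_apply _ (PointedCover.U₂_anti h b c) _ ⟨hx.1.2, hx.2⟩).symm
  · refine Eq.trans (b := ((cupCochain s t).2.1 a b).1 x)
      (SectionPresheaf.restr_apply _ (PointedCover.U₂_anti h a b) _ hx) ?_
    rw [cupCochain_snd _ _ _ _ hx, cupCochain_snd _ _ _ _ (PointedCover.U₂_anti h a b hx)]
    exact congrArg₂ (fun (n : ℤ) (y : ℝ) => n * y)
      (SectionPresheaf.restr_apply _ (PointedCover.U₂_anti h a b) _ hx).symm
      (SectionPresheaf.restr_apply _ (h b) _ hx.2).symm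
  · refine Eq.trans (b := ((cupCochain s t).2.2 a).1 x)
      (SectionPresheaf.restr_apply _ (h a) _ hx) ?_
    rw [cupCochain_trd, cupCochain_trd]
    have e : extd _ (ref0 _ h t.2 a) = (sheafA1 I X).restr (h a) (extd _ (t.2 a)) :=
      extd_restr (h a) (t.2 a)
    refine Eq.trans ?_ (congrArg (fun z : (sheafA1 I X).sec (𝔙.U a) =>
      (ref0 _ h s.2 a).1 x • z.1 x) e).symm
    exact congrArg₂ (fun (y : ℝ) (v : TangentSpace I x →L[ℝ] ℝ) => y • v)
      (SectionPresheaf.restr_apply _ (h a) _ hx).symm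
      (SectionPresheaf.restr_apply _ (h a) _ hx).symm

theorem cechCup_refine (h : 𝔘 ≤ 𝔙) (f g : CechH1 I 𝔘) :
    refH2 I X 𝔘 𝔙 h (cechCup 𝔘 f g) = cechCup 𝔙 (refH1 I X 𝔘 𝔙 h f) (refH1 I X 𝔘 𝔙 h g) := by
  induction f using Cohomology.induction with | _ s =>
  induction g using Cohomology.induction with | _ t =>
  exact congrArg (Cohomology.mk _ _) (Subtype.ext (cupCochain_refine h s.1 t.1))

variable (I X) in
/-- The cup product as a map of sets. -/
noncomputable def cupFun : DeligneH1 I X → DeligneH1 I X → DeligneH2 I X :=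
  DirectLimit.map₂ (refH1 I X) (refH1 I X) (refH2 I X) (fun 𝔘 f g => cechCup 𝔘 f g)
    fun _ _ h f g => cechCup_refine h f g

theorem cupFun_mk (f g : CechH1 I 𝔘) :
    cupFun I X (DeligneH1.mk I 𝔘 f) (DeligneH1.mk I 𝔘 g) = DeligneH2.mk I 𝔘 (cechCup 𝔘 f g) :=
  DirectLimit.map₂_def ..

variable (I X) in
/-- The cup product `H¹(X, ℤ(1)) × H¹(X, ℤ(1)) → H²(X, ℤ(2))`. -/
noncomputable def cup : DeligneH1 I X →+ DeligneH1 I X →+ DeligneH2 I X :=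
  AddMonoidHom.mk' (fun f => AddMonoidHom.mk' (cupFun I X f) fun g g' => by
      obtain ⟨𝔘, f, g, g', rfl, rfl, rfl⟩ := DeligneH1.exists_mk₃ I f g g'
      simp only [← map_add, cupFun_mk])
    fun f f' => AddMonoidHom.ext fun g => by
      obtain ⟨𝔘, f, f', g, rfl, rfl, rfl⟩ := DeligneH1.exists_mk₃ I f f' g
      refine Eq.trans (b := cupFun I X (DeligneH1.mk I 𝔘 f + DeligneH1.mk I 𝔘 f')
        (DeligneH1.mk I 𝔘 g)) rfl (Eq.trans (b := cupFun I X (DeligneH1.mk I 𝔘 f)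
        (DeligneH1.mk I 𝔘 g) + cupFun I X (DeligneH1.mk I 𝔘 f') (DeligneH1.mk I 𝔘 g)) ?_ rfl)
      rw [← map_add, cupFun_mk, cupFun_mk, cupFun_mk, ← map_add, map_add, AddMonoidHom.add_apply]

theorem cup_mk (f g : CechH1 I 𝔘) :
    cup I X (DeligneH1.mk I 𝔘 f) (DeligneH1.mk I 𝔘 g) = DeligneH2.mk I 𝔘 (cechCup 𝔘 f g) :=
  cupFun_mk f g

end Cup

section Circle

/-- The standard parametrization `t ↦ e^{2πit}` of the circle, which fixes its orientation. -/
noncomputable def param (t : ℝ) : Circle := Circle.exp (2 * Real.pi * t)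

theorem param_add_one (t : ℝ) : param (t + 1) = param t := by
  simp [param, mul_add, Circle.exp_add]

theorem contMDiff_param : ContMDiff 𝓘(ℝ, ℝ) (𝓡 1) ∞ param :=
  contMDiff_circleExp.comp (contDiff_const.mul contDiff_id).contMDiff

theorem continuous_param : Continuous param := contMDiff_param.continuous

/-- The coefficient `h` in `param^* η = h(t) dt`. -/
noncomputable def pull (η : ∀ x : Circle, TangentSpace (𝓡 1) x →L[ℝ] ℝ) (t : ℝ) : ℝ :=
  η (param t) (mfderiv 𝓘(ℝ, ℝ) (𝓡 1) param t (1 : ℝ))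

instance : IsManifold (𝓡 1) ∞ Circle := .of_le (n := ω) le_top

theorem continuousOn_pull {W : TopologicalSpace.Opens Circle} (η : (sheafA1 (𝓡 1) Circle).sec W) :
    ContinuousOn (pull η.1) (param ⁻¹' W) := by
  intro t ht
  apply ContinuousAt.continuousWithinAt
  have h1 : ContMDiffAt 𝓘(ℝ, ℝ) ((𝓡 1).prod 𝓘(ℝ, EuclideanSpace ℝ (Fin 1) →L[ℝ] ℝ)) ∞
      (fun t => Bundle.TotalSpace.mk' (EuclideanSpace ℝ (Fin 1) →L[ℝ] ℝ)
        (E := fun x : Circle => TangentSpace (𝓡 1) x →L[ℝ] Bundle.Trivial Circle ℝ x)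
        (param t) (η.1 (param t))) t :=
    ((η.2.1 (param t) ht).contMDiffAt (W.isOpen.mem_nhds ht)).comp t (contMDiff_param t)
  have h2 : ContMDiffAt 𝓘(ℝ, ℝ) (𝓡 1).tangent ∞
      (fun t => Bundle.TotalSpace.mk' (EuclideanSpace ℝ (Fin 1))
        (E := (TangentSpace (𝓡 1) : Circle → Type _))
        (param t) (mfderiv 𝓘(ℝ, ℝ) (𝓡 1) param t (1 : ℝ))) t := by
    have h3 : ContMDiff 𝓘(ℝ, ℝ) 𝓘(ℝ, ℝ).tangent ∞
        (fun t : ℝ => (⟨t, (1 : ℝ)⟩ : TangentBundle 𝓘(ℝ, ℝ) ℝ)) := by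
      intro t
      rw [Bundle.contMDiffAt_totalSpace]
      refine ⟨contMDiffAt_id, ?_⟩
      simp only [TangentBundle.trivializationAt_apply]
      refine (contMDiffAt_const (I := 𝓘(ℝ, ℝ)) (I' := 𝓘(ℝ, ℝ)) (c := (1 : ℝ))).congr_of_eventuallyEq
        (Filter.Eventually.of_forall fun y => ?_)
      simp
      exact deriv_id _
    exact ((contMDiff_param.contMDiff_tangentMap le_rfl).comp h3) t
  have h4 := ContMDiffAt.clm_bundle_apply (F₂ := ℝ) (E₂ := Bundle.Trivial Circle ℝ)
    (ϕ := fun t => η.1 (param t)) h1 h2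
  have h5 := (Bundle.contMDiffAt_totalSpace.1 h4).2
  exact h5.continuousAt

theorem pull_extd {W : TopologicalSpace.Opens Circle} (f : (sheafA0 (𝓡 1) Circle).sec W) {t : ℝ}
    (ht : param t ∈ W) : HasDerivAt (fun t => f.1 (param t)) (pull (extd W f).1 t) t := by
  have hf := mdifferentiableAt_of_sec f ht
  have hp : MDifferentiableAt 𝓘(ℝ, ℝ) (𝓡 1) param t := contMDiff_param.mdifferentiable (by simp) t
  have h0 : MDifferentiableAt 𝓘(ℝ, ℝ) 𝓘(ℝ, ℝ) (f.1 ∘ param) t := hf.comp t hp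
  have h1 : DifferentiableAt ℝ (f.1 ∘ param) t := mdifferentiableAt_iff_differentiableAt.1 h0
  have h2 := mvfderiv_comp_apply t hf hp (1 : ℝ)
  have h3 : pull (extd W f).1 t = deriv (f.1 ∘ param) t := by
    simp only [pull, extd_apply _ ht]
    refine h2.symm.trans ?_
    rw [mvfderiv, mfderiv_eq_fderiv]
    rfl
  rw [h3]
  exact h1.hasDerivAt

/-- A pair `(K, φ)` subordinate to the cover `𝔘`: `K` is the triangulation of the circle with the
vertices `e^{2πij/N}`, `N ≥ 3`, and `φ` assigns to each edge `[j/N, (j+1)/N]` the index `e j` and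
to each vertex the index `v j` of a member of the cover that contains it. -/
structure Triangulation (𝔘 : PointedCover Circle) where
  N : ℕ
  three_le : 3 ≤ N
  e : ℕ → Circle
  v : ℕ → Circle
  v_last : v N = v 0
  edge_mem : ∀ i < N, ∀ t ∈ Icc ((i : ℝ) / N) ((i + 1 : ℕ) / N), param t ∈ 𝔘.U (e i)
  vertex_mem : ∀ i ≤ N, param (i / N) ∈ 𝔘.U (v i)

variable {𝔘 : PointedCover Circle}

/-- Contribution of the edge `[s, t]` with label `e` and of the flags of its end points, with labels
`v` and `w`: `∫_{[s,t]} ω¹_e + ω⁰_{ew}(t) - ω⁰_{ev}(s)`. -/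
noncomputable def edgeTerm (c : C2 (𝓡 1) 𝔘) (e v w : Circle) (s t : ℝ) : ℝ :=
  (∫ u in s..t, pull (c.2.2 e).1 u) +
    ((c.2.1 e w).1 (param t) - (c.2.1 e v).1 (param s))

/-- `∫_{(K, φ)} (n, ω⁰, ω¹)`. -/
noncomputable def cochainIntegral (K : Triangulation 𝔘) (c : C2 (𝓡 1) 𝔘) : ℝ :=
  ∑ i ∈ Finset.range K.N, edgeTerm c (K.e i) (K.v i) (K.v (i + 1)) (i / K.N) ((i + 1 : ℕ) / K.N)

theorem pull_intervalIntegrable (c : C2 (𝓡 1) 𝔘) {e : Circle} {s t : ℝ} (hst : s ≤ t)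
    (h : ∀ u ∈ Icc s t, param u ∈ 𝔘.U e) :
    IntervalIntegrable (pull (c.2.2 e).1) MeasureTheory.volume s t := by
  apply ContinuousOn.intervalIntegrable
  rw [uIcc_of_le hst]
  exact (continuousOn_pull (c.2.2 e)).mono h

theorem div_le_div_succ (i N : ℕ) : (i : ℝ) / N ≤ ((i + 1 : ℕ) : ℝ) / N := by
  gcongr
  simp

theorem edgeTerm_add (c c' : C2 (𝓡 1) 𝔘) {e : Circle} (v w : Circle) {s t : ℝ} (hst : s ≤ t)
    (h : ∀ u ∈ Icc s t, param u ∈ 𝔘.U e) :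
    edgeTerm (c + c') e v w s t = edgeTerm c e v w s t + edgeTerm c' e v w s t := by
  have h1 : (∫ u in s..t, pull ((c + c').2.2 e).1 u) =
      (∫ u in s..t, pull (c.2.2 e).1 u) + ∫ u in s..t, pull (c'.2.2 e).1 u :=
    intervalIntegral.integral_add (pull_intervalIntegrable c hst h)
      (pull_intervalIntegrable c' hst h)
  have h2 : ((c + c').2.1 e w).1 (param t) =
    (c.2.1 e w).1 (param t) + (c'.2.1 e w).1 (param t) := rfl
  have h3 : ((c + c').2.1 e v).1 (param s) =
    (c.2.1 e v).1 (param s) + (c'.2.1 e v).1 (param s) := rfl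
  simp only [edgeTerm]
  rw [h1, h2, h3]
  ring

theorem cochainIntegral_add (K : Triangulation 𝔘) (c c' : C2 (𝓡 1) 𝔘) :
    cochainIntegral K (c + c') = cochainIntegral K c + cochainIntegral K c' := by
  simp only [cochainIntegral]
  rw [← Finset.sum_add_distrib]
  exact Finset.sum_congr rfl fun i hi => edgeTerm_add c c' _ _ (div_le_div_succ i K.N)
    (K.edge_mem i (Finset.mem_range.1 hi))

theorem integral_pull_extd {W : TopologicalSpace.Opens Circle} (f : (sheafA0 (𝓡 1) Circle).sec W)
    {s t : ℝ} (hst : s ≤ t) (h : ∀ u ∈ Icc s t, param u ∈ W) :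
    ∫ u in s..t, pull (extd W f).1 u = f.1 (param t) - f.1 (param s) := by
  apply intervalIntegral.integral_eq_sub_of_hasDerivAt
  · intro u hu
    rw [uIcc_of_le hst] at hu
    exact pull_extd f (h u hu)
  · apply ContinuousOn.intervalIntegrable
    rw [uIcc_of_le hst]
    exact (continuousOn_pull _).mono h

/-- The integral of a coboundary is an integer. -/
theorem cochainIntegral_D1 (K : Triangulation 𝔘) (w : C1 (𝓡 1) 𝔘) :
    ∃ n : ℤ, cochainIntegral K (D1 (𝓡 1) 𝔘 w) = n := by
  have key : ∀ i ∈ Finset.range K.N,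
      edgeTerm (D1 (𝓡 1) 𝔘 w) (K.e i) (K.v i) (K.v (i + 1)) (i / K.N) ((i + 1 : ℕ) / K.N) =
      ((w.2 (K.v (i + 1))).1 (param ((i + 1 : ℕ) / K.N)) - (w.2 (K.v i)).1 (param (i / K.N))) +
      (((w.1 (K.e i) (K.v i)).1 (param (i / K.N))
        - (w.1 (K.e i) (K.v (i + 1))).1 (param ((i + 1 : ℕ) / K.N)) : ℤ) : ℝ) := by
    intro i hi
    have hi' := Finset.mem_range.1 hi
    have hle := div_le_div_succ i K.N
    have hE := K.edge_mem i hi'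
    have h1 : ∫ u in ((i : ℝ) / K.N)..((i + 1 : ℕ) / K.N), pull ((D1 (𝓡 1) 𝔘 w).2.2 (K.e i)).1 u =
        _ := integral_pull_extd (w.2 (K.e i)) hle hE
    have h2 : ∀ (v : Circle) (x : Circle), x ∈ 𝔘.U₂ (K.e i) v →
        ((D1 (𝓡 1) 𝔘 w).2.1 (K.e i) v).1 x =
          (w.2 v).1 x - (w.2 (K.e i)).1 x - (w.1 (K.e i) v).1 x := fun v x hx =>
      congrArg (· - ((w.1 (K.e i) v).1 x : ℝ)) (delta0_apply _ _ _ hx)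
    rw [edgeTerm, h1, h2 _ _ ⟨hE _ (right_mem_Icc.2 hle), K.vertex_mem _ hi'⟩,
      h2 _ _ ⟨hE _ (left_mem_Icc.2 hle), K.vertex_mem _ hi'.le⟩]
    push_cast
    ring
  refine ⟨∑ i ∈ Finset.range K.N, ((w.1 (K.e i) (K.v i)).1 (param (i / K.N))
        - (w.1 (K.e i) (K.v (i + 1))).1 (param ((i + 1 : ℕ) / K.N))), ?_⟩
  have hN : (K.N : ℝ) ≠ 0 := by
    have := K.three_le
    positivity
  have hp : param 1 = param 0 := by simpa using param_add_one 0
  rw [cochainIntegral, Finset.sum_congr rfl key, Finset.sum_add_distrib,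
    Finset.sum_range_sub (fun i => (w.2 (K.v i)).1 (param ((i : ℕ) / K.N))), K.v_last,
    div_self hN, hp]
  push_cast
  simp

theorem two_cocycle_A0 {I : ModelWithCorners ℝ (EuclideanSpace ℝ (Fin 1)) (EuclideanSpace ℝ (Fin 1))}
    [IsManifold I ∞ Circle] {c : C2 I 𝔘} (hc : D2 I 𝔘 c = 0) (a b g : Circle) {x : Circle}
    (hx : x ∈ 𝔘.U₃ a b g) :
    (c.2.1 b g).1 x - (c.2.1 a g).1 x + (c.2.1 a b).1 x + (c.1 a b g).1 x = 0 := by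
  have h1 := congrFun (congrFun (congrFun (congrArg (fun z => z.2.1) hc) a) b) g
  have h2 : (delta1 _ 𝔘 c.2.1 a b g).1 x + ((c.1 a b g).1 x : ℝ) = 0 :=
    congrFun (congrArg Subtype.val h1) x
  rwa [delta1_apply _ _ _ _ hx] at h2

theorem two_cocycle_pull {c : C2 (𝓡 1) 𝔘} (hc : D2 (𝓡 1) 𝔘 c = 0) (a b : Circle) {u : ℝ}
    (hx : param u ∈ 𝔘.U₂ a b) :
    pull (c.2.2 b).1 u - pull (c.2.2 a).1 u = pull (extd _ (c.2.1 a b)).1 u := by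
  have h1 := congrFun (congrFun (congrArg (fun z => z.2.2) hc) a) b
  have h2 : delta0 _ 𝔘 c.2.2 a b = extd _ (c.2.1 a b) := sub_eq_zero.1 h1
  rw [← h2]
  simp only [pull]
  rw [delta0_apply _ _ _ hx]
  rfl

/-- Effect of a change of labels on the contribution of an edge. -/
theorem edgeTerm_relabel {c : C2 (𝓡 1) 𝔘} (hc : D2 (𝓡 1) 𝔘 c = 0) {a b v v' w w' : Circle}
    {s t : ℝ} (hst : s ≤ t) (ha : ∀ u ∈ Icc s t, param u ∈ 𝔘.U a)
    (hb : ∀ u ∈ Icc s t, param u ∈ 𝔘.U b) (hv : param s ∈ 𝔘.U v) (hw : param s ∈ 𝔘.U w)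
    (hv' : param t ∈ 𝔘.U v') (hw' : param t ∈ 𝔘.U w') :
    ∃ n : ℤ, edgeTerm c b w w' s t - edgeTerm c a v v' s t =
      ((c.2.1 v' w').1 (param t) - (c.2.1 v w).1 (param s)) + n := by
  have hs := left_mem_Icc.2 hst
  have ht := right_mem_Icc.2 hst
  have h1 : (∫ u in s..t, pull (c.2.2 b).1 u) - ∫ u in s..t, pull (c.2.2 a).1 u =
      (c.2.1 a b).1 (param t) - (c.2.1 a b).1 (param s) := by
    rw [← intervalIntegral.integral_sub (pull_intervalIntegrable c hst hb)
      (pull_intervalIntegrable c hst ha), ← integral_pull_extd (c.2.1 a b) hst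
        fun u hu => ⟨ha u hu, hb u hu⟩]
    refine intervalIntegral.integral_congr fun u hu => ?_
    rw [uIcc_of_le hst] at hu
    exact two_cocycle_pull hc a b ⟨ha u hu, hb u hu⟩
  have e1 := two_cocycle_A0 hc a b w' (x := param t) ⟨⟨ha t ht, hb t ht⟩, hw'⟩
  have e2 := two_cocycle_A0 hc a v' w' (x := param t) ⟨⟨ha t ht, hv'⟩, hw'⟩
  have e3 := two_cocycle_A0 hc a b w (x := param s) ⟨⟨ha s hs, hb s hs⟩, hw⟩
  have e4 := two_cocycle_A0 hc a v w (x := param s) ⟨⟨ha s hs, hv⟩, hw⟩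
  refine ⟨(c.1 a v' w').1 (param t) - (c.1 a b w').1 (param t) - (c.1 a v w).1 (param s)
    + (c.1 a b w).1 (param s), ?_⟩
  simp only [edgeTerm]
  push_cast
  linear_combination h1 + e1 - e2 - e3 + e4

theorem Triangulation.N_ne_zero (K : Triangulation 𝔘) : (K.N : ℝ) ≠ 0 := by
  have := K.three_le
  positivity

theorem cochainIntegral_relabel {c : C2 (𝓡 1) 𝔘} (hc : D2 (𝓡 1) 𝔘 c = 0)
    (K L : Triangulation 𝔘) (h : L.N = K.N) :
    ∃ n : ℤ, cochainIntegral L c - cochainIntegral K c = n := by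
  have key : ∀ i : ℕ, ∃ n : ℤ, i < K.N →
      edgeTerm c (L.e i) (L.v i) (L.v (i + 1)) (i / K.N) ((i + 1 : ℕ) / K.N) -
      edgeTerm c (K.e i) (K.v i) (K.v (i + 1)) (i / K.N) ((i + 1 : ℕ) / K.N) =
      ((c.2.1 (K.v (i + 1)) (L.v (i + 1))).1 (param ((i + 1 : ℕ) / K.N))
        - (c.2.1 (K.v i) (L.v i)).1 (param (i / K.N))) + n := by
    intro i
    by_cases hi : i < K.N
    · obtain ⟨n, hn⟩ := edgeTerm_relabel hc (div_le_div_succ i K.N) (K.edge_mem i hi)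
        (by rw [← h]; exact L.edge_mem i (h ▸ hi)) (K.vertex_mem i hi.le)
        (by rw [← h]; exact L.vertex_mem i (h ▸ hi.le)) (K.vertex_mem (i + 1) hi)
        (by rw [← h]; exact L.vertex_mem (i + 1) (h ▸ hi))
      exact ⟨n, fun _ => hn⟩
    · exact ⟨0, fun h => absurd h hi⟩
  choose n hn using key
  refine ⟨∑ i ∈ Finset.range K.N, n i, ?_⟩
  have hp : param 1 = param 0 := by simpa using param_add_one 0
  rw [cochainIntegral, cochainIntegral, h, ← Finset.sum_sub_distrib,
    Finset.sum_congr rfl fun i hi => hn i (Finset.mem_range.1 hi), Finset.sum_add_distrib,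
    Finset.sum_range_sub (fun i => (c.2.1 (K.v i) (L.v i)).1 (param ((i : ℕ) / K.N))), K.v_last,
    ← h, L.v_last, div_self L.N_ne_zero, hp]
  push_cast
  simp

theorem sum_range_mul' (f : ℕ → ℝ) (n m : ℕ) :
    ∑ j ∈ Finset.range (n * m), f j =
      ∑ i ∈ Finset.range n, ∑ r ∈ Finset.range m, f (i * m + r) := by
  induction n with
  | zero => simp
  | succ n ih => rw [Nat.succ_mul, Finset.sum_range_add, ih, Finset.sum_range_succ]

/-- Subdivision of every edge into `M` edges of equal length. -/
noncomputable def Triangulation.subdivide (K : Triangulation 𝔘) (M : ℕ) (hM : 0 < M) :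
    Triangulation 𝔘 where
  N := K.N * M
  three_le := K.three_le.trans (Nat.le_mul_of_pos_right _ hM)
  e j := K.e (j / M)
  v j := if M ∣ j then K.v (j / M) else K.e (j / M)
  v_last := by simp [hM, K.v_last]
  edge_mem j hj t ht := by
    have hj' : j / M < K.N := Nat.div_lt_of_lt_mul (by rwa [mul_comm])
    have hM' : (0 : ℝ) < M := by exact_mod_cast hM
    have hN : (0 : ℝ) < K.N := lt_of_le_of_ne (Nat.cast_nonneg _) K.N_ne_zero.symm
    have h1 : j / M * M ≤ j := Nat.div_mul_le_self j M
    have h2 : j + 1 ≤ (j / M + 1) * M := Nat.lt_mul_of_div_lt (Nat.lt_succ_self _) hM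
    refine K.edge_mem _ hj' t ⟨le_trans ?_ ht.1, le_trans ht.2 ?_⟩
    · rw [Nat.cast_mul, div_le_div_iff₀ hN (by positivity)]
      have : ((j / M : ℕ) : ℝ) * M ≤ j := by exact_mod_cast h1
      nlinarith
    · rw [Nat.cast_mul, div_le_div_iff₀ (by positivity) hN]
      have : ((j + 1 : ℕ) : ℝ) ≤ ((j / M + 1 : ℕ) : ℝ) * M := by exact_mod_cast h2
      nlinarith
  vertex_mem j hj := by
    have hM' : (0 : ℝ) < M := by exact_mod_cast hM
    have hN : (0 : ℝ) < K.N := lt_of_le_of_ne (Nat.cast_nonneg _) K.N_ne_zero.symm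
    by_cases hd : M ∣ j
    · obtain ⟨i, rfl⟩ := hd
      have hi : i ≤ K.N := Nat.le_of_mul_le_mul_left (by rwa [mul_comm M K.N]) hM
      have := K.vertex_mem i hi
      have e : ((M * i : ℕ) : ℝ) / (K.N * M : ℕ) = i / K.N := by
        push_cast
        field_simp
      simp only [dvd_mul_right, if_true, Nat.mul_div_cancel_left _ hM]
      rwa [e]
    · simp only [hd, if_false]
      have hlt : j < K.N * M := lt_of_le_of_ne hj fun h => hd (h ▸ dvd_mul_left _ _)
      have hj' : j / M < K.N := Nat.div_lt_of_lt_mul (by rwa [mul_comm])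
      have h1 : j / M * M ≤ j := Nat.div_mul_le_self j M
      have h2 : j + 1 ≤ (j / M + 1) * M := Nat.lt_mul_of_div_lt (Nat.lt_succ_self _) hM
      refine K.edge_mem _ hj' _ ⟨?_, ?_⟩
      · rw [Nat.cast_mul, div_le_div_iff₀ hN (by positivity)]
        have : ((j / M : ℕ) : ℝ) * M ≤ j := by exact_mod_cast h1
        nlinarith
      · rw [Nat.cast_mul, div_le_div_iff₀ (by positivity) hN]
        have : (j : ℝ) ≤ ((j / M + 1 : ℕ) : ℝ) * M := by exact_mod_cast (Nat.le_succ j).trans h2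
        nlinarith

theorem cochainIntegral_subdivide (K : Triangulation 𝔘) (M : ℕ) (hM : 0 < M) (c : C2 (𝓡 1) 𝔘) :
    cochainIntegral (K.subdivide M hM) c = cochainIntegral K c := by
  have hM' : (M : ℝ) ≠ 0 := by exact_mod_cast hM.ne'
  have hN := K.N_ne_zero
  rw [cochainIntegral, cochainIntegral]
  change ∑ j ∈ Finset.range (K.N * M), _ = _
  rw [sum_range_mul']
  refine Finset.sum_congr rfl fun i hi => ?_
  have hi' := Finset.mem_range.1 hi
  set T : ℕ → ℝ := fun r => ((i * M + r : ℕ) : ℝ) / (K.N * M : ℕ) with hT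
  set L : ℕ → Circle := fun r => (K.subdivide M hM).v (i * M + r) with hL
  have hdiv : ∀ r < M, (i * M + r) / M = i := fun r hr => by
    rw [mul_comm, Nat.mul_add_div hM, Nat.div_eq_of_lt hr, add_zero]
  have T0 : T 0 = i / K.N := by
    simp only [hT]
    push_cast
    field_simp
    ring
  have TM : T M = (i + 1 : ℕ) / K.N := by
    simp only [hT]
    push_cast
    field_simp
  have L0 : L 0 = K.v i := by
    simp [hL, Triangulation.subdivide, Nat.mul_div_cancel _ hM]
  have LM : L M = K.v (i + 1) := by
    have : i * M + M = (i + 1) * M := by ring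
    simp [hL, Triangulation.subdivide, this, Nat.mul_div_cancel _ hM]
  have hmem : ∀ r < M, ∀ u ∈ Icc (T r) (T (r + 1)), param u ∈ 𝔘.U (K.e i) := fun r hr u hu => by
    have h1 : i * M + r < K.N * M := by nlinarith
    have h2 := (K.subdivide M hM).edge_mem (i * M + r) h1 u hu
    have h3 : (K.subdivide M hM).e (i * M + r) = K.e i := congrArg K.e (hdiv r hr)
    rwa [h3] at h2
  have step : ∀ r ∈ Finset.range M,
      edgeTerm c ((K.subdivide M hM).e (i * M + r)) (L r) (L (r + 1)) (T r) (T (r + 1)) =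
      (∫ u in T r..T (r + 1), pull (c.2.2 (K.e i)).1 u) +
        ((c.2.1 (K.e i) (L (r + 1))).1 (param (T (r + 1)))
          - (c.2.1 (K.e i) (L r)).1 (param (T r))) := fun r hr => by
    have h3 : (K.subdivide M hM).e (i * M + r) = K.e i :=
      congrArg K.e (hdiv r (Finset.mem_range.1 hr))
    rw [h3]
    rfl
  refine (Finset.sum_congr rfl step).trans ?_
  rw [Finset.sum_add_distrib, intervalIntegral.sum_integral_adjacent_intervals,
    Finset.sum_range_sub (fun r => (c.2.1 (K.e i) (L r)).1 (param (T r))), T0, TM, L0, LM]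
  · rfl
  · intro r hr
    exact pull_intervalIntegrable c (by simp only [hT]; gcongr; simp) (hmem r hr)

/-- The integral of a cocycle modulo `ℤ` does not depend on the triangulation and its labels. -/
theorem cochainIntegral_indep {c : C2 (𝓡 1) 𝔘} (hc : D2 (𝓡 1) 𝔘 c = 0)
    (K L : Triangulation 𝔘) :
    ((cochainIntegral K c : ℝ) : AddCircle (1 : ℝ)) = (cochainIntegral L c : ℝ) := by
  have hK : 0 < K.N := lt_of_lt_of_le (by norm_num) K.three_le
  have hL : 0 < L.N := lt_of_lt_of_le (by norm_num) L.three_le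
  obtain ⟨n, hn⟩ := cochainIntegral_relabel hc (L.subdivide K.N hK) (K.subdivide L.N hL)
    (mul_comm _ _)
  rw [cochainIntegral_subdivide, cochainIntegral_subdivide] at hn
  rw [← sub_eq_zero, ← AddCircle.coe_sub, hn]
  exact (AddCircle.coe_eq_zero_iff 1).2 ⟨n, by simp⟩

theorem exists_triangulation (𝔘 : PointedCover Circle) : Nonempty (Triangulation 𝔘) := by
  obtain ⟨δ, hδ, h⟩ := lebesgue_number_lemma_of_metric (s := Icc (0 : ℝ) 1)
    (c := fun x : Circle => param ⁻¹' (𝔘.U x)) isCompact_Icc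
    (fun x => (𝔘.U x).isOpen.preimage continuous_param)
    (fun t _ => mem_iUnion.2 ⟨param t, 𝔘.mem _⟩)
  obtain ⟨n, hn⟩ := exists_nat_gt (1 / δ)
  have hN : (0 : ℝ) < (n + 3 : ℕ) := by positivity
  have hlt : 1 / ((n + 3 : ℕ) : ℝ) < δ := by
    rw [div_lt_iff₀ hN]
    rw [div_lt_iff₀ hδ] at hn
    push_cast
    nlinarith
  have key : ∀ i : ℕ, ∃ x : Circle, i < n + 3 →
      ∀ t ∈ Icc ((i : ℝ) / (n + 3 : ℕ)) ((i + 1 : ℕ) / (n + 3 : ℕ)), param t ∈ 𝔘.U x := by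
    intro i
    by_cases hi : i < n + 3
    · obtain ⟨x, hx⟩ := h (i / (n + 3 : ℕ)) ⟨by positivity, by
        rw [div_le_one hN]
        exact_mod_cast hi.le⟩
      refine ⟨x, fun _ t ht => hx ?_⟩
      rw [Metric.mem_ball, Real.dist_eq, abs_of_nonneg (sub_nonneg.2 ht.1)]
      have h2 := ht.2
      rw [Nat.cast_succ, add_div] at h2
      linarith
    · exact ⟨1, fun h => absurd h hi⟩
  choose e he using key
  exact ⟨{ N := n + 3
           three_le := Nat.le_add_left _ _
           e := e
           v := fun i => param (i / (n + 3 : ℕ))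
           v_last := by
             rw [div_self hN.ne']
             simpa using param_add_one 0
           edge_mem := he
           vertex_mem := fun i _ => 𝔘.mem _ }⟩

/-- The integral of a cocycle modulo `ℤ`, for a choice of a pair `(K, φ)`. -/
noncomputable def cocycleIntegral (𝔘 : PointedCover Circle) :
    (D2 (𝓡 1) 𝔘).ker →+ AddCircle (1 : ℝ) :=
  AddMonoidHom.mk' (fun z => ((cochainIntegral (exists_triangulation 𝔘).some z.1 : ℝ) :
      AddCircle (1 : ℝ))) fun z z' =>
    (congrArg (fun r : ℝ => (r : AddCircle (1 : ℝ)))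
      (cochainIntegral_add (exists_triangulation 𝔘).some z.1 z'.1)).trans
      (AddCircle.coe_add 1 _ _)

theorem cocycleIntegral_apply (K : Triangulation 𝔘) (z : (D2 (𝓡 1) 𝔘).ker) :
    cocycleIntegral 𝔘 z = ((cochainIntegral K z.1 : ℝ) : AddCircle (1 : ℝ)) :=
  cochainIntegral_indep (AddMonoidHom.mem_ker.1 z.2) (exists_triangulation 𝔘).some K

theorem cocycleIntegral_coboundary (z : (D2 (𝓡 1) 𝔘).ker) (h : ∃ w, D1 (𝓡 1) 𝔘 w = z.1) :
    cocycleIntegral 𝔘 z = 0 := by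
  obtain ⟨w, hw⟩ := h
  obtain ⟨K⟩ := exists_triangulation 𝔘
  obtain ⟨n, hn⟩ := cochainIntegral_D1 K w
  rw [cocycleIntegral_apply K, ← hw, hn]
  exact (AddCircle.coe_eq_zero_iff 1).2 ⟨n, by simp⟩

/-- The integration on `Ȟ²(𝔘, ℤ(2))`. -/
noncomputable def cechIntegral (𝔘 : PointedCover Circle) : CechH2 (𝓡 1) 𝔘 →+ AddCircle (1 : ℝ) :=
  Cohomology.lift (cocycleIntegral 𝔘) cocycleIntegral_coboundary

theorem cechIntegral_mk (K : Triangulation 𝔘) (z : (D2 (𝓡 1) 𝔘).ker) :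
    cechIntegral 𝔘 (Cohomology.mk _ _ z) = ((cochainIntegral K z.1 : ℝ) : AddCircle (1 : ℝ)) :=
  cocycleIntegral_apply K z

/-- A triangulation subordinate to a cover is subordinate to any coarser cover. -/
def Triangulation.coarsen {𝔘 𝔙 : PointedCover Circle} (h : 𝔘 ≤ 𝔙) (K : Triangulation 𝔙) :
    Triangulation 𝔘 where
  N := K.N
  three_le := K.three_le
  e := K.e
  v := K.v
  v_last := K.v_last
  edge_mem i hi t ht := h _ (K.edge_mem i hi t ht)
  vertex_mem i hi := h _ (K.vertex_mem i hi)

theorem cochainIntegral_coarsen {𝔘 𝔙 : PointedCover Circle} (h : 𝔘 ≤ 𝔙) (K : Triangulation 𝔙)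
    (c : C2 (𝓡 1) 𝔘) : cochainIntegral (K.coarsen h) c = cochainIntegral K
      (((ref2 _ h).prodMap ((ref1 _ h).prodMap (ref0 _ h))) c) := by
  refine Finset.sum_congr rfl fun i hi => ?_
  have hi' := Finset.mem_range.1 hi
  have hle := div_le_div_succ i K.N
  have hE := K.edge_mem i hi'
  have h1 : ∫ u in ((i : ℝ) / K.N)..((i + 1 : ℕ) / K.N), pull (c.2.2 (K.e i)).1 u =
      ∫ u in ((i : ℝ) / K.N)..((i + 1 : ℕ) / K.N), pull (ref0 _ h c.2.2 (K.e i)).1 u := by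
    refine intervalIntegral.integral_congr fun u hu => ?_
    rw [uIcc_of_le hle] at hu
    simp only [pull]
    exact congrArg (fun l : TangentSpace (𝓡 1) (param u) →L[ℝ] ℝ => l _)
      (SectionPresheaf.restr_apply _ (h (K.e i)) (c.2.2 (K.e i)) (hE u hu)).symm
  have h2 : ∀ (v x : Circle), x ∈ 𝔙.U₂ (K.e i) v →
      (c.2.1 (K.e i) v).1 x = (ref1 _ h c.2.1 (K.e i) v).1 x := fun v x hx =>
    (SectionPresheaf.restr_apply _ (PointedCover.U₂_anti h (K.e i) v) _ hx).symm
  exact congrArg₂ (· + ·) h1 (congrArg₂ (· - ·)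
    (h2 _ _ ⟨hE _ (right_mem_Icc.2 hle), K.vertex_mem _ hi'⟩)
    (h2 _ _ ⟨hE _ (left_mem_Icc.2 hle), K.vertex_mem _ hi'.le⟩))

theorem cechIntegral_refine {𝔘 𝔙 : PointedCover Circle} (h : 𝔘 ≤ 𝔙) (f : CechH2 (𝓡 1) 𝔘) :
    cechIntegral 𝔘 f = cechIntegral 𝔙 (refH2 (𝓡 1) Circle 𝔘 𝔙 h f) := by
  induction f using Cohomology.induction with | _ z =>
  obtain ⟨K⟩ := exists_triangulation 𝔙
  refine (cechIntegral_mk (K.coarsen h) z).trans (Eq.trans ?_ (cechIntegral_mk K _).symm)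
  exact congrArg (fun r : ℝ => (r : AddCircle (1 : ℝ))) (cochainIntegral_coarsen h K z.1)

/-- The integration as a map of sets. -/
noncomputable def integralFun : DeligneH2 (𝓡 1) Circle → AddCircle (1 : ℝ) :=
  DirectLimit.lift (refH2 (𝓡 1) Circle) (fun 𝔘 f => cechIntegral 𝔘 f)
    fun _ _ h f => cechIntegral_refine h f

theorem integralFun_mk (f : CechH2 (𝓡 1) 𝔘) :
    integralFun (DeligneH2.mk (𝓡 1) 𝔘 f) = cechIntegral 𝔘 f := rfl

/-- The integration `∫_{S¹} : H²(S¹, ℤ(2)) → ℝ/ℤ`. -/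
noncomputable def integral : DeligneH2 (𝓡 1) Circle →+ AddCircle (1 : ℝ) :=
  AddMonoidHom.mk' integralFun fun x y => by
    obtain ⟨𝔘, f, g, _, rfl, rfl, _⟩ := DeligneH2.exists_mk₃ (𝓡 1) x y y
    rw [← map_add, integralFun_mk, integralFun_mk, integralFun_mk, map_add]

theorem integral_mk (f : CechH2 (𝓡 1) 𝔘) :
    integral (DeligneH2.mk (𝓡 1) 𝔘 f) = cechIntegral 𝔘 f := rfl

end Circle

section CentralExtensions

/-- A normalized 2-cocycle on the group `A` with values in the trivial module `ℝ/ℤ`. -/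
structure Cocycle2 (A : Type*) [Group A] where
  toFun : A → A → AddCircle (1 : ℝ)
  cocycle : ∀ a b d, toFun a b + toFun (a * b) d = toFun a (b * d) + toFun b d
  map_one_one : toFun 1 1 = 0

/-- A bimultiplicative map is a 2-cocycle. -/
def Cocycle2.ofBimul {A : Type*} [Group A] (c : A → A → AddCircle (1 : ℝ))
    (h1 : ∀ a b d, c (a * b) d = c a d + c b d) (h2 : ∀ a b d, c a (b * d) = c a b + c a d) :
    Cocycle2 A where
  toFun := c
  cocycle a b d := by rw [h1, h2]; abel
  map_one_one := by simpa using h1 1 1 1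

variable {A : Type*} [Group A] (c : Cocycle2 A)

theorem Cocycle2.one_left (a : A) : c.toFun 1 a = 0 := by
  have h := c.cocycle 1 1 a
  simpa [c.map_one_one] using h

theorem Cocycle2.one_right (a : A) : c.toFun a 1 = 0 := by
  have h := c.cocycle a 1 1
  simpa [c.map_one_one] using h

theorem Cocycle2.inv_comm (a : A) : c.toFun a⁻¹ a = c.toFun a a⁻¹ := by
  have h := c.cocycle a a⁻¹ a
  simpa [c.one_left, c.one_right] using h.symm

/-- The central extension of `A` by the circle `𝕋` defined by `c`: the set `A × 𝕋` with the
multiplication `(a, u)(b, v) = (ab, u v exp(2πi c(a, b)))`. -/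
@[ext] structure CentralExt (c : Cocycle2 A) where
  base : A
  fiber : Circle

namespace CentralExt

variable {c}

noncomputable instance : Mul (CentralExt c) :=
  ⟨fun x y => ⟨x.base * y.base, x.fiber * y.fiber * (c.toFun x.base y.base).toCircle⟩⟩

noncomputable instance : One (CentralExt c) := ⟨⟨1, 1⟩⟩

noncomputable instance : Inv (CentralExt c) :=
  ⟨fun x => ⟨x.base⁻¹, x.fiber⁻¹ * (-c.toFun x.base x.base⁻¹).toCircle⟩⟩

@[simp] theorem mul_base (x y : CentralExt c) : (x * y).base = x.base * y.base := rfl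
@[simp] theorem mul_fiber (x y : CentralExt c) :
    (x * y).fiber = x.fiber * y.fiber * (c.toFun x.base y.base).toCircle := rfl
@[simp] theorem one_base : (1 : CentralExt c).base = 1 := rfl
@[simp] theorem one_fiber : (1 : CentralExt c).fiber = 1 := rfl
@[simp] theorem inv_base (x : CentralExt c) : x⁻¹.base = x.base⁻¹ := rfl
@[simp] theorem inv_fiber (x : CentralExt c) :
    x⁻¹.fiber = x.fiber⁻¹ * (-c.toFun x.base x.base⁻¹).toCircle := rfl

noncomputable instance : Group (CentralExt c) :=
  Group.ofLeftAxioms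
    (fun x y z => CentralExt.ext (mul_assoc _ _ _) (by
      have h := congrArg AddCircle.toCircle (c.cocycle x.base y.base z.base)
      rw [AddCircle.toCircle_add, AddCircle.toCircle_add] at h
      simp only [mul_fiber, mul_base]
      calc _ = x.fiber * y.fiber * z.fiber * ((c.toFun x.base y.base).toCircle *
            (c.toFun (x.base * y.base) z.base).toCircle) := by ac_rfl
        _ = _ := by rw [h]; ac_rfl))
    (fun x => CentralExt.ext (one_mul _) (by simp [c.one_left]))
    (fun x => CentralExt.ext (inv_mul_cancel _) (by
      simp [c.inv_comm, AddCircle.toCircle_neg]))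

variable (c)

/-- The extension `1 → 𝕋 → CentralExt c → A → 1`, with the maps `u ↦ (1, u)`, `(a, u) ↦ a`. -/
noncomputable def extension : GroupExtension Circle (CentralExt c) A where
  inl :=
    { toFun := fun u => ⟨1, u⟩
      map_one' := rfl
      map_mul' := fun u v => CentralExt.ext (mul_one _).symm (by simp [c.map_one_one]) }
  rightHom :=
    { toFun := base
      map_one' := rfl
      map_mul' := fun _ _ => rfl }
  inl_injective _ _ h := congrArg fiber h
  range_inl_eq_ker_rightHom := by
    ext x
    refine ⟨?_, fun h => ⟨x.fiber, CentralExt.ext (MonoidHom.mem_ker.1 h).symm rfl⟩⟩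
    rintro ⟨u, rfl⟩
    rfl
  rightHom_surjective a := ⟨⟨a, 1⟩, rfl⟩

theorem inl_mem_center (u : Circle) : (extension c).inl u ∈ Subgroup.center (CentralExt c) := by
  rw [Subgroup.mem_center_iff]
  intro x
  refine CentralExt.ext ?_ ?_
  · exact (mul_one x.base).trans (one_mul x.base).symm
  · change x.fiber * u * (c.toFun x.base 1).toCircle = u * x.fiber * (c.toFun 1 x.base).toCircle
    rw [c.one_left, c.one_right, mul_comm u]

/-- The subgroup `ℤ₂ = {1, -1}` of the circle, as a subgroup of the central extension. -/
noncomputable def Z₂ : Subgroup (CentralExt c) := (powMonoidHom 2 : Circle →* Circle).ker.map (extension c).inl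

instance : (Z₂ c).Normal where
  conj_mem := by
    rintro _ ⟨u, hu, rfl⟩ x
    rw [Subgroup.mem_center_iff.1 (inl_mem_center c u) x, mul_inv_cancel_right]
    exact ⟨u, hu, rfl⟩

theorem sq_surjective : Function.Surjective (powMonoidHom 2 : Circle →* Circle) := fun u => by
  obtain ⟨t, rfl⟩ := Circle.exp_surjective u
  refine ⟨Circle.exp (t / 2), ?_⟩
  rw [powMonoidHom_apply, sq, ← Circle.exp_add, add_halves]

/-- The map `𝕋 → CentralExt c ⧸ ℤ₂` obtained from `𝕋 → CentralExt c` and from the identification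
of `𝕋 ⧸ ℤ₂` with `𝕋` by squaring: it takes `u²` to the class of `(1, u)`. -/
noncomputable def quotInl : Circle →* CentralExt c ⧸ Z₂ c :=
  (powMonoidHom 2 : Circle →* Circle).liftOfSurjective sq_surjective
    ⟨(QuotientGroup.mk' (Z₂ c)).comp (extension c).inl, fun u hu => MonoidHom.mem_ker.2
      ((QuotientGroup.eq_one_iff _).2 ⟨u, hu, rfl⟩)⟩

theorem quotInl_sq (u : Circle) :
    quotInl c (u ^ 2) = QuotientGroup.mk' (Z₂ c) ((extension c).inl u) :=
  MonoidHom.liftOfRightInverse_comp_apply _ _ _ _ u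

/-- The projection `CentralExt c ⧸ ℤ₂ → A`. -/
noncomputable def quotRightHom : CentralExt c ⧸ Z₂ c →* A :=
  QuotientGroup.lift (Z₂ c) (extension c).rightHom (by
    rintro _ ⟨u, -, rfl⟩
    rfl)

/-- The central extension `1 → 𝕋 → CentralExt c ⧸ ℤ₂ → A → 1`. -/
noncomputable def quotExtension : GroupExtension Circle (CentralExt c ⧸ Z₂ c) A where
  inl := quotInl c
  rightHom := quotRightHom c
  inl_injective := (injective_iff_map_eq_one _).2 fun u hu => by
    obtain ⟨v, rfl⟩ := sq_surjective u
    have h : quotInl c (v ^ 2) = 1 := hu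
    rw [quotInl_sq] at h
    obtain ⟨w, hw, h'⟩ := (QuotientGroup.eq_one_iff _).1 h
    rw [← (extension c).inl_injective h']
    exact hw
  range_inl_eq_ker_rightHom := by
    ext x
    constructor
    · rintro ⟨u, rfl⟩
      obtain ⟨v, rfl⟩ := sq_surjective u
      change quotRightHom c (quotInl c (v ^ 2)) = 1
      rw [quotInl_sq]
      rfl
    · induction x using QuotientGroup.induction_on with | _ x =>
      intro h
      obtain ⟨u, rfl⟩ : x ∈ (extension c).inl.range := by
        rw [(extension c).range_inl_eq_ker_rightHom]
        exact h
      exact ⟨u ^ 2, quotInl_sq c u⟩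
  rightHom_surjective a := ⟨QuotientGroup.mk' (Z₂ c) ⟨a, 1⟩, rfl⟩

end CentralExt

end CentralExtensions

section GaugeGroup

/-- `S(f, g) = ∫_{S¹} f ∪ g` for `f, g ∈ H¹(S¹, ℤ(1))`. -/
noncomputable def S (f g : DeligneH1 (𝓡 1) Circle) : AddCircle (1 : ℝ) :=
  integral (cup (𝓡 1) Circle f g)

/-- The group `𝒢(S¹) = H¹(S¹, ℤ(1))`, written multiplicatively. -/
abbrev GaugeGroup : Type := Multiplicative (DeligneH1 (𝓡 1) Circle)

noncomputable def SCocycle : Cocycle2 GaugeGroup :=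
  .ofBimul (fun f g => S f.toAdd g.toAdd)
    (fun f f' g => by simp only [S, toAdd_mul, map_add, AddMonoidHom.add_apply])
    (fun f g g' => by simp only [S, toAdd_mul, map_add])

/-- The central extension `𝒢~(S¹) = 𝒢(S¹) × 𝕋`, `(f, u)(g, v) = (f + g, u v exp(2πi S(f, g)))`. -/
abbrev GTilde : Type := CentralExt SCocycle

end GaugeGroup

section LoopGroup

/-- The group `L𝕋` of smooth loops in the circle. -/
abbrev LT : Type := C^∞⟮𝓡 1, Circle; 𝓡 1, Circle⟯

instance : LieGroup (𝓡 1) ∞ Circle := .of_le (n := ω) le_top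

/-- `F : ℝ → ℝ` is a smooth function such that `f(e^{2πit}) = e^{2πiF(t)}`. -/
def IsLift (f : LT) (F : ℝ → ℝ) : Prop :=
  ContDiff ℝ ∞ F ∧ ∀ t, f (param t) = Circle.exp (2 * Real.pi * F t)

theorem contMDiff_circle_coe : ContMDiff (𝓡 1) 𝓘(ℝ, ℂ) ∞ (fun z : Circle => (z : ℂ)) :=
  haveI : Fact (Module.finrank ℝ ℂ = 1 + 1) := ⟨Complex.finrank_real_complex⟩
  contMDiff_coe_sphere (E := ℂ) (n := 1)

theorem exists_lift (f : LT) : ∃ F, IsLift f F := by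
  set g : ℝ → ℂ := fun t => (f (param t) : ℂ) with hg
  have hgs : ContDiff ℝ ∞ g := by
    exact (contMDiff_circle_coe.comp (f.contMDiff.comp contMDiff_param)).contDiff
  have hd : ∀ t, HasDerivAt g (deriv g t) t := fun t =>
    (hgs.differentiable (by simp) t).hasDerivAt
  have hn : ∀ t, g t * star (g t) = 1 := fun t => by
    simp [hg, Complex.mul_conj]
  have hd' : ContDiff ℝ ∞ (deriv g) := (contDiff_infty_iff_deriv.1 hgs).2
  set p : ℝ → ℝ := fun t => (2 * Real.pi)⁻¹ * (deriv g t * star (g t)).im with hp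
  have hps : ContDiff ℝ ∞ p := by
    refine contDiff_const.mul (Complex.imCLM.contDiff.comp (hd'.mul ?_))
    exact (Complex.conjCLE.contDiff).comp hgs
  have hre : ∀ t, (deriv g t * star (g t)).re = 0 := fun t => by
    have h1 := (hd t).mul (hd t).star
    have h2 : (fun t => g t * star (g t)) = fun _ => 1 := funext hn
    have h3 := h1.unique (by
      have := hasDerivAt_const t (1 : ℂ)
      rw [← h2] at this
      exact this)
    have h4 := congrArg Complex.re h3
    simp at h4 ⊢
    linarith
  obtain ⟨θ, hθ⟩ := Circle.exp_surjective (f (param 0))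
  set F : ℝ → ℝ := fun t => (2 * Real.pi)⁻¹ * θ + ∫ u in (0 : ℝ)..t, p u with hF
  have hFd : ∀ t, HasDerivAt F (p t) t := fun t =>
    (intervalIntegral.integral_hasDerivAt_right (hps.continuous.intervalIntegrable _ _)
      (hps.continuous.stronglyMeasurableAtFilter _ _) hps.continuous.continuousAt).const_add _
  have hFs : ContDiff ℝ ∞ F := contDiff_infty_iff_deriv.2
    ⟨fun t => (hFd t).differentiableAt, by
      rw [show deriv F = p from funext fun t => (hFd t).deriv]
      exact hps⟩
  refine ⟨F, hFs, fun t => ?_⟩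
  set h : ℝ → ℂ := fun t => g t * Complex.exp (-(2 * Real.pi * F t : ℝ) * Complex.I) with hh
  have hder : ∀ t, HasDerivAt h 0 t := fun t => by
    have h1 : HasDerivAt (fun t => (-(2 * Real.pi * F t : ℝ) * Complex.I : ℂ))
        (-(2 * Real.pi * p t : ℝ) * Complex.I) t := by
      have := (((hFd t).const_mul (2 * Real.pi)).ofReal_comp.neg).mul_const Complex.I
      exact this
    have h2 := (hd t).mul h1.cexp
    refine h2.congr_deriv ?_
    have h3 : deriv g t = ((2 * Real.pi * p t : ℝ) * Complex.I) * g t := by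
      have e1 : deriv g t * star (g t) = (2 * Real.pi * p t : ℝ) * Complex.I := by
        apply Complex.ext
        · rw [hre]; simp
        · simp [hp]
          field_simp
      rw [← e1, mul_assoc, mul_comm (star (g t)), hn, mul_one]
    rw [h3]
    ring
  have hconst : h t = h 0 := is_const_of_deriv_eq_zero (fun t => (hder t).differentiableAt)
    (fun t => (hder t).deriv) t 0
  have hF0 : 2 * Real.pi * F 0 = θ := by
    simp [hF]
    field_simp
  have h0 : h 0 = 1 := by
    simp only [hh, hF0, hg, ← hθ, Circle.coe_exp, ← Complex.exp_add]
    simp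
  rw [h0] at hconst
  apply Circle.ext
  rw [Circle.coe_exp]
  have h5 : g t = g t * Complex.exp (-(2 * Real.pi * F t : ℝ) * Complex.I) *
      Complex.exp ((2 * Real.pi * F t : ℝ) * Complex.I) := by
    rw [mul_assoc, ← Complex.exp_add]
    simp
  change g t = _
  rw [h5]
  change h t * _ = _
  rw [hconst, one_mul]

theorem exp_eq_exp {x y : ℝ} (h : Circle.exp (2 * Real.pi * x) = Circle.exp (2 * Real.pi * y)) :
    ∃ n : ℤ, x = y + n := by
  obtain ⟨n, hn⟩ := Circle.exp_eq_exp.1 h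
  refine ⟨n, ?_⟩
  have : (2 * Real.pi) ≠ 0 := by positivity
  apply mul_left_cancel₀ this
  rw [hn]
  ring

theorem IsLift.mul {f g : LT} {F G : ℝ → ℝ} (hF : IsLift f F) (hG : IsLift g G) :
    IsLift (f * g) (F + G) :=
  ⟨hF.1.add hG.1, fun t => by
    change f (param t) * g (param t) = Circle.exp (2 * Real.pi * (F t + G t))
    rw [hF.2, hG.2, ← Circle.exp_add, mul_add]⟩

/-- Two lifts differ by an integer constant. -/
theorem IsLift.unique {f : LT} {F F' : ℝ → ℝ} (hF : IsLift f F) (hF' : IsLift f F') :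
    ∃ n : ℤ, F' = fun t => F t + n := by
  have h : ∀ t, ∃ n : ℤ, F' t - F t = n := fun t => by
    obtain ⟨n, hn⟩ := exp_eq_exp ((hF'.2 t).symm.trans (hF.2 t))
    exact ⟨n, by rw [hn]; ring⟩
  choose n hn using h
  have hc : Continuous fun t => ((n t : ℤ) : ℝ) := by
    simp only [← hn]
    exact hF'.1.continuous.sub hF.1.continuous
  have hc' : Continuous n := Int.isClosedEmbedding_coe_real.isInducing.continuous_iff.2 hc
  refine ⟨n 0, funext fun t => ?_⟩
  rw [← PreconnectedSpace.constant inferInstance hc' (x := t) (y := 0), ← hn]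
  ring

/-- The increment of a lift over a period is an integer. -/
theorem IsLift.sub_int {f : LT} {F : ℝ → ℝ} (hF : IsLift f F) : ∃ n : ℤ, F 1 - F 0 = n := by
  have h := (hF.2 1).symm.trans ((congrArg f (by simpa using param_add_one 0)).trans (hF.2 0))
  obtain ⟨n, hn⟩ := exp_eq_exp h
  exact ⟨n, by rw [hn]; ring⟩

theorem integral_add_mul {p q u : ℝ → ℝ} (hp : Continuous p) (hq : Continuous q)
    (hu : Continuous u) : ∫ t in (0 : ℝ)..1, (p t + q t) * u t =
      (∫ t in (0 : ℝ)..1, p t * u t) + ∫ t in (0 : ℝ)..1, q t * u t := by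
  have h1 : Continuous fun t => p t * u t := hp.mul hu
  have h2 : Continuous fun t => q t * u t := hq.mul hu
  simp only [add_mul]
  exact intervalIntegral.integral_add (h1.intervalIntegrable _ _) (h2.intervalIntegrable _ _)

/-- The real number
`½ (∫₀¹ F(t) G'(t) dt + F̄ Δ_G + Δ_F (Ḡ - G(0)))`, with `Δ_F = F(1) - F(0)`, `F̄ = ∫₀¹ F(t) dt`. -/
noncomputable def psReal (F G : ℝ → ℝ) : ℝ :=
  1 / 2 * ((∫ t in (0 : ℝ)..1, F t * deriv G t) + (∫ t in (0 : ℝ)..1, F t) * (G 1 - G 0) +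
    (F 1 - F 0) * ((∫ t in (0 : ℝ)..1, G t) - G 0))

theorem psReal_add_left {F F' G : ℝ → ℝ} (hF : ContDiff ℝ ∞ F) (hF' : ContDiff ℝ ∞ F')
    (hG : ContDiff ℝ ∞ G) : psReal (F + F') G = psReal F G + psReal F' G := by
  have hG' : Continuous (deriv G) := (contDiff_infty_iff_deriv.1 hG).2.continuous
  have h1 : ∫ t in (0 : ℝ)..1, (F + F') t * deriv G t =
      (∫ t in (0 : ℝ)..1, F t * deriv G t) + ∫ t in (0 : ℝ)..1, F' t * deriv G t :=
    integral_add_mul hF.continuous hF'.continuous hG'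
  have h2 : ∫ t in (0 : ℝ)..1, (F + F') t =
      (∫ t in (0 : ℝ)..1, F t) + ∫ t in (0 : ℝ)..1, F' t :=
    intervalIntegral.integral_add (hF.continuous.intervalIntegrable _ _)
      (hF'.continuous.intervalIntegrable _ _)
  rw [psReal, h1, h2, psReal, psReal, Pi.add_apply, Pi.add_apply]
  ring

theorem psReal_add_right {F G G' : ℝ → ℝ} (hF : ContDiff ℝ ∞ F) (hG : ContDiff ℝ ∞ G)
    (hG' : ContDiff ℝ ∞ G') : psReal F (G + G') = psReal F G + psReal F G' := by
  have hG1 : Continuous (deriv G) := (contDiff_infty_iff_deriv.1 hG).2.continuous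
  have hG2 : Continuous (deriv G') := (contDiff_infty_iff_deriv.1 hG').2.continuous
  have h1 : ∫ t in (0 : ℝ)..1, F t * deriv (G + G') t =
      (∫ t in (0 : ℝ)..1, F t * deriv G t) + ∫ t in (0 : ℝ)..1, F t * deriv G' t := by
    have h := integral_add_mul hG1 hG2 hF.continuous
    simp only [mul_comm _ (F _)] at h
    rw [← h]
    congr 1
    funext t
    rw [deriv_add (hG.differentiable (by simp) t) (hG'.differentiable (by simp) t)]
  have h2 : ∫ t in (0 : ℝ)..1, (G + G') t =
      (∫ t in (0 : ℝ)..1, G t) + ∫ t in (0 : ℝ)..1, G' t :=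
    intervalIntegral.integral_add (hG.continuous.intervalIntegrable _ _)
      (hG'.continuous.intervalIntegrable _ _)
  rw [psReal, h1, h2, psReal, psReal, Pi.add_apply, Pi.add_apply]
  ring

theorem integral_const_one (n : ℤ) (G : ℝ → ℝ) (hG : Continuous G) :
    ∫ t in (0 : ℝ)..1, (G t + n) = (∫ t in (0 : ℝ)..1, G t) + n := by
  rw [intervalIntegral.integral_add (hG.intervalIntegrable _ _)
    (continuous_const.intervalIntegrable _ _)]
  simp

theorem psReal_shift {F G : ℝ → ℝ} (hF : ContDiff ℝ ∞ F) (hG : ContDiff ℝ ∞ G) (n m : ℤ) :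
    psReal (fun t => F t + n) (fun t => G t + m) = psReal F G + n * (G 1 - G 0) := by
  have hG' : Continuous (deriv G) := (contDiff_infty_iff_deriv.1 hG).2.continuous
  have h1 : ∫ t in (0 : ℝ)..1, (F t + n) * deriv (fun t => G t + m) t =
      (∫ t in (0 : ℝ)..1, F t * deriv G t) + n * (G 1 - G 0) := by
    simp only [deriv_add_const]
    rw [integral_add_mul hF.continuous continuous_const hG', intervalIntegral.integral_const_mul,
      intervalIntegral.integral_deriv_eq_sub (fun t _ => hG.differentiable (by simp) t)
      (hG'.intervalIntegrable _ _)]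
  rw [psReal, h1, integral_const_one n F hF.continuous, integral_const_one m G hG.continuous,
    psReal]
  ring

theorem coe_add_int (x : ℝ) (n : ℤ) : ((x + n : ℝ) : AddCircle (1 : ℝ)) = x := by
  rw [AddCircle.coe_add]
  have : ((n : ℝ) : AddCircle (1 : ℝ)) = 0 := (AddCircle.coe_eq_zero_iff 1).2 ⟨n, by simp⟩
  rw [this, add_zero]

/-- A choice of a lift. -/
noncomputable def lift (f : LT) : ℝ → ℝ := (exists_lift f).choose

theorem isLift_lift (f : LT) : IsLift f (lift f) := (exists_lift f).choose_spec

/-- The group 2-cocycle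
`c(f, g) = ½ (∫₀¹ F(t) G'(t) dt + F̄ Δ_G + Δ_F (Ḡ - G(0))) mod ℤ` of `L𝕋`. -/
noncomputable def psFun (f g : LT) : AddCircle (1 : ℝ) := (psReal (lift f) (lift g) : ℝ)

/-- The value `c(f, g)` can be computed from any lifts of `f` and `g`. -/
theorem psFun_eq {f g : LT} {F G : ℝ → ℝ} (hF : IsLift f F) (hG : IsLift g G) :
    psFun f g = (psReal F G : ℝ) := by
  obtain ⟨n, hn⟩ := hF.unique (isLift_lift f)
  obtain ⟨m, hm⟩ := hG.unique (isLift_lift g)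
  obtain ⟨k, hk⟩ := hG.sub_int
  rw [psFun, hn, hm, psReal_shift hF.1 hG.1, hk, ← Int.cast_mul, coe_add_int]

noncomputable def psCocycle : Cocycle2 LT :=
  .ofBimul psFun
    (fun f f' g => by
      rw [psFun_eq ((isLift_lift f).mul (isLift_lift f')) (isLift_lift g),
        psReal_add_left (isLift_lift f).1 (isLift_lift f').1 (isLift_lift g).1,
        AddCircle.coe_add]
      rfl)
    (fun f g g' => by
      rw [psFun_eq (isLift_lift f) ((isLift_lift g).mul (isLift_lift g')),
        psReal_add_right (isLift_lift f).1 (isLift_lift g).1 (isLift_lift g').1,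
        AddCircle.coe_add]
      rfl)

/-- The universal central extension of `L𝕋` of Pressley and Segal, given by the cocycle `c`. -/
abbrev LTHat : Type := CentralExt psCocycle

/-- The group 1-cochain `T(f) = Δ_F F̄ mod ℤ` of `L𝕋`. -/
noncomputable def T (f : LT) : AddCircle (1 : ℝ) :=
  ((lift f 1 - lift f 0) * ∫ t in (0 : ℝ)..1, lift f t : ℝ)

/-- The value `T(f)` can be computed from any lift of `f`. -/
theorem T_eq {f : LT} {F : ℝ → ℝ} (hF : IsLift f F) :
    T f = ((F 1 - F 0) * ∫ t in (0 : ℝ)..1, F t : ℝ) := by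
  obtain ⟨n, hn⟩ := hF.unique (isLift_lift f)
  obtain ⟨k, hk⟩ := hF.sub_int
  rw [T, hn, integral_const_one n F hF.1.continuous, add_sub_add_right_eq_sub, hk, mul_add,
    ← Int.cast_mul, coe_add_int]

end LoopGroup

end SmoothDeligne

/-!
A cocycle `(k, τ)` for `ℤ(1)` satisfies `τ_b - τ_a = k_{ab}`, so that the functions `exp(2πi τ_a)`
are the restrictions of one smooth circle-valued function. It is trivial exactly when all `τ_a` are
integer-valued, and then `(k, τ) = D τ`; conversely, branches of the logarithm on a fine enough cover
make a cocycle out of a circle-valued function. This gives `H¹(X, ℤ(1)) ≃ C^∞(X, 𝕋)` for every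
manifold `X` (`deligneLoopEquiv`), and `e` is the case of the circle.

For `S`, fix lifts `F`, `G` of the two loops. Over an edge `τ_e = F + m` and `dθ_e = G' dt` with an
integer `m`, and modulo `ℤ` the terms at the end points cancel everything that depends on the label
`e` of the edge (`edgeTerm_cup`). What remains besides `∫ F G'` telescopes around the circle, and the
failure of `F` to be periodic leaves `-Δ_F G(0)` (`cochainIntegral_cup`).

The identity `S - 2c = δT` is then an identity between real numbers attached to the lifts
(`integral_sub_two_nsmul_psFun`). Dividing by `ℤ₂` and identifying `𝕋 ⧸ ℤ₂` with `𝕋` by squaring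
doubles the cocycle `c`, so the quotient extension has the cocycle `2c`, which is cohomologous to `S`
through `T`. The isomorphism is therefore multiplication of the fibre coordinate by `exp(2πi T)`
(`CentralExt.toQuot`); it is bijective because it is so on the base and on the central circle.
-/

namespace SmoothDeligne

/-! ### Integer-valued sections -/

theorem exp_two_pi_add_int (x : ℝ) (n : ℤ) :
    Circle.exp (2 * Real.pi * (x + n)) = Circle.exp (2 * Real.pi * x) :=
  Circle.exp_eq_exp.2 ⟨n, by ring⟩

theorem exp_eq_one_iff_int {x : ℝ} : Circle.exp (2 * Real.pi * x) = 1 ↔ ∃ n : ℤ, x = n := by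
  constructor
  · intro h
    obtain ⟨n, hn⟩ := exp_eq_exp (x := x) (y := 0) (by simpa using h)
    exact ⟨n, by simpa using hn⟩
  · rintro ⟨n, rfl⟩
    simpa using exp_two_pi_add_int 0 n

theorem continuousOn_round {Y : Type*} [TopologicalSpace Y] {φ : Y → ℝ} {s : Set Y}
    (hφ : ContinuousOn φ s) (h : ∀ x ∈ s, ∃ n : ℤ, φ x = n) :
    ContinuousOn (fun x => round (φ x)) s := by
  refine Int.isClosedEmbedding_coe_real.isInducing.continuousOn_iff.2 (hφ.congr fun x hx => ?_)
  obtain ⟨n, hn⟩ := h x hx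
  simp [hn]

/-- A continuous integer-valued function on a preconnected set is constant. -/
theorem exists_int_of_isPreconnected {Y : Type*} [TopologicalSpace Y] {φ : Y → ℝ} {s : Set Y}
    (hs : IsPreconnected s) (hφ : ContinuousOn φ s) (h : ∀ x ∈ s, ∃ n : ℤ, φ x = n) :
    ∃ n : ℤ, ∀ x ∈ s, φ x = n := by
  rcases s.eq_empty_or_nonempty with rfl | ⟨y, hy⟩
  · exact ⟨0, by simp⟩
  refine ⟨round (φ y), fun x hx => ?_⟩
  obtain ⟨n, hn⟩ := h x hx
  rw [hs.constant (continuousOn_round hφ h) hy hx, hn, round_intCast]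

section Loops

variable {E : Type*} [NormedAddCommGroup E] [NormedSpace ℝ E] {H : Type*} [TopologicalSpace H]
  {I : ModelWithCorners ℝ E H} {X : Type*} [TopologicalSpace X] [ChartedSpace H X]

/-- The locally constant integer-valued function underlying a smooth function with integer
values. -/
noncomputable def roundSec {W : TopologicalSpace.Opens X} (f : (sheafA0 I X).sec W)
    (h : ∀ x ∈ W, ∃ n : ℤ, f.1 x = n) : (sheafZ X).sec W :=
  ⟨fun x => round (f.1 x), continuousOn_round f.2.1.continuousOn h,
    fun x hx => by simp [f.2.2 x hx]⟩

theorem coe_roundSec {W : TopologicalSpace.Opens X} (f : (sheafA0 I X).sec W)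
    (h : ∀ x ∈ W, ∃ n : ℤ, f.1 x = n) {x : X} (hx : x ∈ W) : ((roundSec f h).1 x : ℝ) = f.1 x := by
  obtain ⟨n, hn⟩ := h x hx
  simp [roundSec, hn]

variable {𝔘 : PointedCover X}

/-! ### From Deligne classes to circle-valued functions -/

/-- The local functions `exp(2πi τ_a)` of a cocycle `(k, τ)` agree on overlaps. -/
theorem exp_section_congr (z : (D1one I 𝔘).ker) {a b x : X} (ha : x ∈ 𝔘.U a) (hb : x ∈ 𝔘.U b) :
    Circle.exp (2 * Real.pi * (z.1.2 a).1 x) = Circle.exp (2 * Real.pi * (z.1.2 b).1 x) := by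
  have h := one_cocycle_iff.1 (AddMonoidHom.mem_ker.1 z.2) a b x ⟨ha, hb⟩
  rw [sub_eq_iff_eq_add'.1 h, exp_two_pi_add_int]

/-- The smooth function `X → 𝕋` which is `exp(2πi τ_a)` on `U_a`. As the cover is indexed by the
points of `X`, its value at `x` can be computed from the member of the cover with index `x`. -/
noncomputable def expLoop (z : (D1one I 𝔘).ker) : C^∞⟮I, X; 𝓡 1, Circle⟯ :=
  ⟨fun x => Circle.exp (2 * Real.pi * (z.1.2 x).1 x), fun a => by
    have hsec : ContMDiffAt I 𝓘(ℝ, ℝ) ∞ (z.1.2 a).1 a :=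
      ((z.1.2 a).2.1 a (𝔘.mem a)).contMDiffAt ((𝔘.U a).isOpen.mem_nhds (𝔘.mem a))
    have hexp : ContMDiff 𝓘(ℝ, ℝ) (𝓡 1) ∞ fun t : ℝ => Circle.exp (2 * Real.pi * t) :=
      contMDiff_param
    refine (hexp.contMDiffAt.comp a hsec).congr_of_eventuallyEq ?_
    filter_upwards [(𝔘.U a).isOpen.mem_nhds (𝔘.mem a)] with x hx
    exact exp_section_congr z (𝔘.mem x) hx⟩

theorem expLoop_apply (z : (D1one I 𝔘).ker) {a x : X} (hx : x ∈ 𝔘.U a) :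
    expLoop z x = Circle.exp (2 * Real.pi * (z.1.2 a).1 x) :=
  exp_section_congr z (𝔘.mem x) hx

variable (𝔘 I) in
/-- `(k, τ) ↦ exp(2πi τ)` on the Cech cohomology of a cover. -/
noncomputable def cechLoop : CechH1 I 𝔘 →+ Additive C^∞⟮I, X; 𝓡 1, Circle⟯ :=
  Cohomology.lift
    (AddMonoidHom.mk' (fun z => Additive.ofMul (expLoop z)) fun z z' =>
      congrArg Additive.ofMul (ContMDiffMap.ext fun x => by
        change Circle.exp (2 * Real.pi * ((z.1.2 x).1 x + (z'.1.2 x).1 x)) =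
          Circle.exp (2 * Real.pi * (z.1.2 x).1 x) * Circle.exp (2 * Real.pi * (z'.1.2 x).1 x)
        rw [mul_add, Circle.exp_add]))
    fun z ⟨n, hn⟩ => congrArg Additive.ofMul (ContMDiffMap.ext fun x => by
      refine exp_eq_one_iff_int.2 ⟨(n x).1 x, ?_⟩
      rw [← hn]
      rfl)

theorem cechLoop_refine {𝔙 : PointedCover X} (h : 𝔘 ≤ 𝔙) (f : CechH1 I 𝔘) :
    cechLoop I 𝔘 f = cechLoop I 𝔙 (refH1 I X 𝔘 𝔙 h f) := by
  induction f using Cohomology.induction with | _ z =>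
  refine congrArg Additive.ofMul (ContMDiffMap.ext fun x => ?_)
  exact congrArg (fun t => Circle.exp (2 * Real.pi * t))
    (SectionPresheaf.restr_apply _ (h x) (z.1.2 x) (𝔙.mem x)).symm

/-- If all `τ_a` are integer-valued then `(k, τ) = D τ`. -/
theorem cechLoop_injective : Function.Injective (cechLoop I 𝔘) := by
  refine (injective_iff_map_eq_zero _).2 fun f hf => ?_
  induction f using Cohomology.induction with | _ z =>
  have hloop : expLoop z = 1 := congrArg Additive.toMul hf
  have hint : ∀ a, ∀ x ∈ 𝔘.U a, ∃ n : ℤ, (z.1.2 a).1 x = n := fun a x hx =>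
    exp_eq_one_iff_int.1 ((expLoop_apply z hx).symm.trans (by rw [hloop]; rfl))
  have hz := one_cocycle_iff.1 (AddMonoidHom.mem_ker.1 z.2)
  refine Cohomology.mk_eq_zero ⟨fun a => roundSec (z.1.2 a) (hint a), Prod.ext ?_ ?_⟩
  · funext a b
    refine SectionPresheaf.sec_ext fun x hx => (delta0_apply _ _ _ hx).trans ?_
    have h := hz a b x hx
    rw [← coe_roundSec _ (hint a) hx.1, ← coe_roundSec _ (hint b) hx.2] at h
    have h' : (roundSec (z.1.2 b) (hint b)).1 x - (roundSec (z.1.2 a) (hint a)).1 x =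
        (z.1.1 a b).1 x :=
      Int.cast_injective (α := ℝ) ((Int.cast_sub _ _).trans h)
    exact h'
  · funext a
    exact SectionPresheaf.sec_ext fun x hx => coe_roundSec _ (hint a) hx

/-! ### Local logarithms -/

/-- The cover by the sets on which `f` differs from its value at the index point by an element of
the slit plane, so that `f` has a logarithm there. -/
noncomputable def logCover (f : C^∞⟮I, X; 𝓡 1, Circle⟯) : PointedCover X where
  U a := ⟨{x | ((f x / f a : Circle) : ℂ) ∈ Complex.slitPlane},
    Complex.isOpen_slitPlane.preimage (continuous_subtype_val.comp
      (f.contMDiff.continuous.div_const _))⟩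
  mem a := by
    change ((f a / f a : Circle) : ℂ) ∈ Complex.slitPlane
    simp

theorem contMDiffOn_arg_div (f : C^∞⟮I, X; 𝓡 1, Circle⟯) (a : X) :
    ContMDiffOn I 𝓘(ℝ, ℝ) ∞ (fun x => Complex.arg (f x / f a : Circle)) ((logCover f).U a) := by
  intro x hx
  have hdiv : ContMDiffAt I 𝓘(ℝ, ℂ) ∞ (fun x => ((f x / f a : Circle) : ℂ)) x :=
    (contMDiff_circle_coe.comp (f.contMDiff.div contMDiff_const)).contMDiffAt
  have hlog : ContMDiffAt 𝓘(ℝ, ℂ) 𝓘(ℝ, ℝ) ∞ (fun w : ℂ => (Complex.log w).im)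
      ((f x / f a : Circle) : ℂ) :=
    (Complex.imCLM.contDiff.contDiffAt.comp _
      ((Complex.contDiffAt_log (n := ∞) hx).restrict_scalars ℝ)).contMDiffAt
  exact ((hlog.comp x hdiv).congr_of_eventuallyEq
    (Filter.Eventually.of_forall fun y => (Complex.log_im _).symm)).contMDiffWithinAt

/-- The local logarithm `τ_a` of `f`, with `exp(2πi τ_a) = f` on `U_a`. -/
noncomputable def logSec (f : C^∞⟮I, X; 𝓡 1, Circle⟯) : Cech0 (sheafA0 I X) (logCover f) := fun a =>
  ⟨res ((logCover f).U a) fun x =>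
      (2 * Real.pi)⁻¹ * (Complex.arg (f x / f a : Circle) + Complex.arg (f a)),
    (contMDiffOn_const.mul ((contMDiffOn_arg_div f a).add contMDiffOn_const)).congr
      fun _ hx => res_apply _ hx,
    fun _ hx => res_apply_of_notMem _ hx⟩

theorem exp_logSec (f : C^∞⟮I, X; 𝓡 1, Circle⟯) {a x : X} (hx : x ∈ (logCover f).U a) :
    Circle.exp (2 * Real.pi * (logSec f a).1 x) = f x := by
  have h : (logSec f a).1 x =
      (2 * Real.pi)⁻¹ * (Complex.arg (f x / f a : Circle) + Complex.arg (f a)) :=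
    res_apply (V := fun _ => ℝ) (W := (logCover f).U a) (fun y =>
      (2 * Real.pi)⁻¹ * (Complex.arg (f y / f a : Circle) + Complex.arg (f a))) hx
  rw [h, mul_inv_cancel_left₀ (by positivity), Circle.exp_add, Circle.exp_arg, Circle.exp_arg,
    div_mul_cancel]

/-- The local logarithms of a smooth function `X → 𝕋` are part of a cocycle. -/
theorem exists_expLoop_eq (f : C^∞⟮I, X; 𝓡 1, Circle⟯) :
    ∃ z : (D1one I (logCover f)).ker, expLoop z = f := by
  have hint : ∀ a b, ∀ x ∈ (logCover f).U₂ a b,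
      ∃ n : ℤ, (delta0 _ _ (logSec f) a b).1 x = n := fun a b x hx => by
    rw [delta0_apply _ _ _ hx]
    obtain ⟨n, hn⟩ := exp_eq_exp ((exp_logSec f hx.2).trans (exp_logSec f hx.1).symm)
    exact ⟨n, by rw [hn]; ring⟩
  refine ⟨⟨(fun a b => roundSec _ (hint a b), logSec f), AddMonoidHom.mem_ker.2 ?_⟩,
    ContMDiffMap.ext fun x => exp_logSec f ((logCover f).mem x)⟩
  refine one_cocycle_iff.2 fun a b x hx => ?_
  rw [coe_roundSec _ (hint a b) hx, delta0_apply _ _ _ hx]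

/-! ### The isomorphism of the Deligne group with the circle-valued functions -/

theorem DeligneH1.exists_mk (x : DeligneH1 I X) :
    ∃ (𝔘 : PointedCover X) (f : CechH1 I 𝔘), x = DeligneH1.mk I 𝔘 f := by
  obtain ⟨𝔘, f, _, _, h, _, _⟩ := DeligneH1.exists_mk₃ I x x x
  exact ⟨𝔘, f, h⟩

variable (I X) in
/-- The homomorphism `H¹(X, ℤ(1)) → C^∞(X, 𝕋)`, `(k, τ) ↦ exp(2πi τ)`. -/
noncomputable def deligneLoop : DeligneH1 I X →+ Additive C^∞⟮I, X; 𝓡 1, Circle⟯ :=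
  AddMonoidHom.mk'
    (DirectLimit.lift (refH1 I X) (fun 𝔘 f => cechLoop I 𝔘 f) fun _ _ h f => cechLoop_refine h f)
    fun x y => by
      obtain ⟨𝔘, f, g, _, rfl, rfl, _⟩ := DeligneH1.exists_mk₃ I x y y
      rw [← map_add]
      exact map_add (cechLoop I 𝔘) f g

theorem deligneLoop_mk (f : CechH1 I 𝔘) :
    deligneLoop I X (DeligneH1.mk I 𝔘 f) = cechLoop I 𝔘 f := rfl

theorem deligneLoop_bijective : Function.Bijective (deligneLoop I X) := by
  refine ⟨(injective_iff_map_eq_zero _).2 fun x hx => ?_, fun f => ?_⟩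
  · obtain ⟨𝔘, f, rfl⟩ := x.exists_mk
    rw [deligneLoop_mk] at hx
    rw [(injective_iff_map_eq_zero _).1 cechLoop_injective f hx, map_zero]
  · obtain ⟨z, hz⟩ := exists_expLoop_eq f.toMul
    exact ⟨DeligneH1.mk I _ (Cohomology.mk _ _ z), congrArg Additive.ofMul hz⟩

variable (I X) in
/-- The isomorphism `H¹(X, ℤ(1)) ≃ C^∞(X, 𝕋)`, `(k, τ) ↦ exp(2πi τ)`. -/
noncomputable def deligneLoopEquiv :
    Multiplicative (DeligneH1 I X) ≃* C^∞⟮I, X; 𝓡 1, Circle⟯ :=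
  (AddEquiv.ofBijective (deligneLoop I X) deligneLoop_bijective).toMultiplicativeLeft

theorem deligneLoopEquiv_mk (z : (D1one I 𝔘).ker) :
    deligneLoopEquiv I X (Multiplicative.ofAdd
      (DeligneH1.mk I 𝔘 (Cohomology.mk (D0 I 𝔘) (D1one I 𝔘) z))) = expLoop z := rfl

end Loops

/-! ### The integral of a cup product over the circle -/

section CupIntegral

variable {𝔘 : PointedCover Circle} {σ θ : (D1one (𝓡 1) 𝔘).ker} {F G : ℝ → ℝ}

/-- Over `U_a` the function `τ_a` differs from a lift of the loop by an integer. -/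
theorem section_eq_lift_add_int (hF : IsLift (expLoop σ) F) {a : Circle} {u : ℝ}
    (hu : param u ∈ 𝔘.U a) : ∃ n : ℤ, (σ.1.2 a).1 (param u) = F u + n :=
  exp_eq_exp ((expLoop_apply σ hu).symm.trans (hF.2 u))

theorem continuousOn_section_sub_lift (hF : IsLift (expLoop σ) F) (a : Circle) :
    ContinuousOn (fun u => (σ.1.2 a).1 (param u) - F u) (param ⁻¹' 𝔘.U a) :=
  ((σ.1.2 a).2.1.continuousOn.comp continuous_param.continuousOn fun _ hu => hu).sub
    hF.1.continuous.continuousOn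

theorem section_sub_lift_int (hF : IsLift (expLoop σ) F) (a : Circle) :
    ∀ u ∈ param ⁻¹' (𝔘.U a : Set Circle), ∃ n : ℤ, (σ.1.2 a).1 (param u) - F u = n := fun u hu => by
  obtain ⟨n, hn⟩ := section_eq_lift_add_int hF hu
  exact ⟨n, by rw [hn]; ring⟩

/-- `param^* dτ_a = F'(t) dt` for every lift `F`. -/
theorem pull_extd_section (hF : IsLift (expLoop σ) F) {a : Circle} {u : ℝ}
    (hu : param u ∈ 𝔘.U a) : pull (extd _ (σ.1.2 a)).1 u = deriv F u := by
  have hmem : param ⁻¹' (𝔘.U a : Set Circle) ∈ nhds u :=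
    ((𝔘.U a).isOpen.preimage continuous_param).mem_nhds hu
  have hround : ContinuousAt (fun t => round ((σ.1.2 a).1 (param t) - F t)) u :=
    (continuousOn_round (continuousOn_section_sub_lift hF a)
      (section_sub_lift_int hF a)).continuousAt hmem
  have hconst : F =ᶠ[nhds u] fun t =>
      (σ.1.2 a).1 (param t) - (round ((σ.1.2 a).1 (param u) - F u) : ℤ) := by
    filter_upwards [hmem, hround.eventually_mem ((isOpen_discrete {_}).mem_nhds rfl)] with t ht htu
    obtain ⟨n, hn⟩ := section_sub_lift_int hF a t ht
    rw [← Set.mem_singleton_iff.1 htu, hn, round_intCast, ← hn]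
    ring
  rw [hconst.deriv_eq]
  exact (((pull_extd (σ.1.2 a) hu).sub_const _).deriv).symm

/-- The contribution of an edge to `∫ σ ∪ θ` is `∫ F G'` up to an integer and the terms
`(τ_v - F) G` at the two end points, which do not depend on the label of the edge. -/
theorem edgeTerm_cup (hF : IsLift (expLoop σ) F) (hG : IsLift (expLoop θ) G) {e v w : Circle}
    {a b : ℝ} (hab : a ≤ b) (he : ∀ u ∈ Icc a b, param u ∈ 𝔘.U e) (hv : param a ∈ 𝔘.U v)
    (hw : param b ∈ 𝔘.U w) :
    ∃ n : ℤ, edgeTerm (cupCochain σ.1 θ.1) e v w a b = (∫ u in a..b, F u * deriv G u) +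
      (((σ.1.2 w).1 (param b) - F b) * G b - ((σ.1.2 v).1 (param a) - F a) * G a) + n := by
  have ha := he a (left_mem_Icc.2 hab)
  have hb := he b (right_mem_Icc.2 hab)
  have hG' : Continuous (deriv G) := (contDiff_infty_iff_deriv.1 hG.1).2.continuous
  have hFG : Continuous fun t => F t * deriv G t := hF.1.continuous.mul hG'
  obtain ⟨m, hm⟩ := exists_int_of_isPreconnected isPreconnected_Icc
    ((continuousOn_section_sub_lift hF e).mono he)
    fun u hu => section_sub_lift_int hF e u (he u hu)
  have hint : ∫ u in a..b, pull ((cupCochain σ.1 θ.1).2.2 e).1 u =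
      (∫ u in a..b, F u * deriv G u) + m * (G b - G a) := by
    have hcongr : ∫ u in a..b, pull ((cupCochain σ.1 θ.1).2.2 e).1 u =
        ∫ u in a..b, (F u * deriv G u + m * deriv G u) := by
      refine intervalIntegral.integral_congr fun u hu => ?_
      rw [uIcc_of_le hab] at hu
      have hpull : pull ((cupCochain σ.1 θ.1).2.2 e).1 u =
        (σ.1.2 e).1 (param u) * pull (extd _ (θ.1.2 e)).1 u := rfl
      beta_reduce
      rw [hpull, pull_extd_section hG (he u hu), sub_eq_iff_eq_add'.1 (hm u hu), add_mul]
    rw [hcongr, intervalIntegral.integral_add (hFG.intervalIntegrable _ _)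
      ((hG'.intervalIntegrable _ _).const_mul _), intervalIntegral.integral_const_mul,
      intervalIntegral.integral_deriv_eq_sub (fun t _ => hG.1.differentiable (by simp) t)
      (hG'.intervalIntegrable _ _)]
  have hσ := one_cocycle_iff.1 (AddMonoidHom.mem_ker.1 σ.2)
  obtain ⟨p, hp⟩ := section_eq_lift_add_int hG hw
  obtain ⟨q, hq⟩ := section_eq_lift_add_int hG hv
  have hkw := hσ e w (param b) ⟨hb, hw⟩
  have hkv := hσ e v (param a) ⟨ha, hv⟩
  have hma := hm a (left_mem_Icc.2 hab)
  have hmb := hm b (right_mem_Icc.2 hab)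
  -- At the end points `k_{ew} θ_w = k_{ew} G + k_{ew} p` with `k_{ew} p` an integer, and the `G` terms
  -- with `k_{ew} = τ_w - τ_e` absorb the term `m (G b - G a)` that comes from `τ_e = F + m`.
  refine ⟨(σ.1.1 e w).1 (param b) * p - (σ.1.1 e v).1 (param a) * q, ?_⟩
  rw [edgeTerm, hint, cupCochain_snd _ _ _ _ ⟨hb, hw⟩, cupCochain_snd _ _ _ _ ⟨ha, hv⟩, hp, hq]
  push_cast
  linear_combination -G b * hkw + G a * hkv - G b * hmb + G a * hma

theorem cochainIntegral_cup (hF : IsLift (expLoop σ) F) (hG : IsLift (expLoop θ) G)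
    (K : Triangulation 𝔘) :
    ((cochainIntegral K (cupCochain σ.1 θ.1) : ℝ) : AddCircle (1 : ℝ)) =
      (((∫ t in (0 : ℝ)..1, F t * deriv G t) - (F 1 - F 0) * G 0 : ℝ) : AddCircle (1 : ℝ)) := by
  have hG' : Continuous (deriv G) := (contDiff_infty_iff_deriv.1 hG.1).2.continuous
  have hFG : Continuous fun t => F t * deriv G t := hF.1.continuous.mul hG'
  have hedge : ∀ i : ℕ, ∃ n : ℤ, i < K.N →
      edgeTerm (cupCochain σ.1 θ.1) (K.e i) (K.v i) (K.v (i + 1)) (i / K.N)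
        ((i + 1 : ℕ) / K.N) = (∫ u in (i / K.N : ℝ)..((i + 1 : ℕ) / K.N), F u * deriv G u) +
      (((σ.1.2 (K.v (i + 1))).1 (param ((i + 1 : ℕ) / K.N)) - F ((i + 1 : ℕ) / K.N)) *
          G ((i + 1 : ℕ) / K.N) -
        ((σ.1.2 (K.v i)).1 (param (i / K.N)) - F (i / K.N)) * G (i / K.N)) + n := by
    intro i
    by_cases hi : i < K.N
    · obtain ⟨n, hn⟩ := edgeTerm_cup hF hG (div_le_div_succ i K.N) (K.edge_mem i hi)
        (K.vertex_mem i hi.le) (K.vertex_mem (i + 1) hi)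
      exact ⟨n, fun _ => hn⟩
    · exact ⟨0, fun h => absurd h hi⟩
  choose n hn using hedge
  obtain ⟨p, hp⟩ := section_eq_lift_add_int hF (a := K.v 0) (u := 0)
    (by simpa using K.vertex_mem 0 (Nat.zero_le _))
  obtain ⟨k, hk⟩ := hF.sub_int
  obtain ⟨l, hl⟩ := hG.sub_int
  have hp1 : param 1 = param 0 := by simpa using param_add_one 0
  -- The terms `(τ_v - F) G` telescope to their values at the two ends of `[0, 1]`, which carry the
  -- same `τ_v`. With `τ_v = F(0) + p` these are `(p - Δ_F) G(1) - p G(0) = (p - Δ_F) Δ_G - Δ_F G(0)`.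
  have hsum : cochainIntegral K (cupCochain σ.1 θ.1) =
      ((∫ t in (0 : ℝ)..1, F t * deriv G t) - (F 1 - F 0) * G 0) +
        (((p - k) * l + ∑ i ∈ Finset.range K.N, n i : ℤ) : ℝ) := by
    rw [cochainIntegral, Finset.sum_congr rfl fun i hi => hn i (Finset.mem_range.1 hi),
      Finset.sum_add_distrib, Finset.sum_add_distrib,
      intervalIntegral.sum_integral_adjacent_intervals (a := fun i : ℕ => (i / K.N : ℝ))
        fun i _ => hFG.intervalIntegrable _ _,
      Finset.sum_range_sub (fun i : ℕ =>
        ((σ.1.2 (K.v i)).1 (param (i / K.N)) - F (i / K.N)) * G (i / K.N)),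
      K.v_last, div_self K.N_ne_zero]
    simp only [Nat.cast_zero, zero_div]
    rw [hp1, hp]
    push_cast
    linear_combination -l * hk + (p - F 1 + F 0) * hl
  rw [hsum, coe_add_int]

/-- `S(f, g) = ∫₀¹ F G' - Δ_F G(0)` for all lifts `F`, `G` of the loops of `f` and `g`. -/
theorem S_eq_of_isLift {f g : GaugeGroup} (hF : IsLift (deligneLoopEquiv (𝓡 1) Circle f) F)
    (hG : IsLift (deligneLoopEquiv (𝓡 1) Circle g) G) :
    S f.toAdd g.toAdd =
      (((∫ t in (0 : ℝ)..1, F t * deriv G t) - (F 1 - F 0) * G 0 : ℝ) : AddCircle (1 : ℝ)) := by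
  obtain ⟨𝔙, x, y, _, hx, hy, _⟩ := DeligneH1.exists_mk₃ (𝓡 1) f.toAdd g.toAdd g.toAdd
  obtain rfl : f = Multiplicative.ofAdd (DeligneH1.mk (𝓡 1) 𝔙 x) := hx
  obtain rfl : g = Multiplicative.ofAdd (DeligneH1.mk (𝓡 1) 𝔙 y) := hy
  induction x using Cohomology.induction with | _ σ =>
  induction y using Cohomology.induction with | _ θ =>
  obtain ⟨K⟩ := exists_triangulation 𝔙
  rw [deligneLoopEquiv_mk] at hF hG
  refine Eq.trans ?_ (cochainIntegral_cup hF hG K)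
  refine (congrArg integral (cup_mk (I := 𝓡 1) _ _)).trans ?_
  exact cechIntegral_mk K (cupCocycle σ θ)

end CupIntegral

/-! ### The coboundary of `T` and the comparison of the extensions -/

/-- `S - 2c = δT`, written in terms of lifts. -/
theorem integral_sub_two_nsmul_psFun {f g : LT} {F G : ℝ → ℝ} (hF : IsLift f F)
    (hG : IsLift g G) :
    (((∫ t in (0 : ℝ)..1, F t * deriv G t) - (F 1 - F 0) * G 0 : ℝ) : AddCircle (1 : ℝ)) -
      2 • psFun f g = T g - T (f * g) + T f := by
  have hmean : ∫ t in (0 : ℝ)..1, (F + G) t =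
      (∫ t in (0 : ℝ)..1, F t) + ∫ t in (0 : ℝ)..1, G t :=
    intervalIntegral.integral_add (hF.1.continuous.intervalIntegrable _ _)
      (hG.1.continuous.intervalIntegrable _ _)
  have hreal : ((∫ t in (0 : ℝ)..1, F t * deriv G t) - (F 1 - F 0) * G 0) -
      (psReal F G + psReal F G) = (G 1 - G 0) * (∫ t in (0 : ℝ)..1, G t) -
        ((F + G) 1 - (F + G) 0) * (∫ t in (0 : ℝ)..1, (F + G) t) +
        (F 1 - F 0) * (∫ t in (0 : ℝ)..1, F t) := by
    rw [hmean, psReal, Pi.add_apply, Pi.add_apply]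
    ring
  rw [psFun_eq hF hG, T_eq hF, T_eq hG, T_eq (hF.mul hG), two_nsmul, ← AddCircle.coe_add,
    ← AddCircle.coe_sub, hreal, AddCircle.coe_add, AddCircle.coe_sub]

namespace CentralExt

variable {A B : Type*} [Group A] [Group B]

theorem mk_eq_quotInl_mul (c : Cocycle2 B) (b : B) (u : Circle) :
    QuotientGroup.mk' (Z₂ c) ⟨b, u⟩ =
      quotInl c (u ^ 2) * QuotientGroup.mk' (Z₂ c) ⟨b, 1⟩ := by
  rw [quotInl_sq, ← map_mul]
  refine congrArg _ (CentralExt.ext (one_mul b).symm ?_)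
  change u = u * 1 * (c.toFun 1 b).toCircle
  simp [c.one_left]

theorem quotInl_mul_comm (c : Cocycle2 B) (u : Circle) (x : CentralExt c ⧸ Z₂ c) :
    quotInl c u * x = x * quotInl c u := by
  obtain ⟨v, hv⟩ := sq_surjective u
  obtain ⟨y, rfl⟩ := QuotientGroup.mk'_surjective _ x
  rw [← hv, powMonoidHom_apply, quotInl_sq, ← map_mul, ← map_mul,
    Subgroup.mem_center_iff.1 (inl_mem_center c v) y]

theorem mk_mul_mk (c : Cocycle2 B) (a b : B) :
    QuotientGroup.mk' (Z₂ c) ⟨a, 1⟩ * QuotientGroup.mk' (Z₂ c) ⟨b, 1⟩ =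
      quotInl c (2 • c.toFun a b).toCircle * QuotientGroup.mk' (Z₂ c) ⟨a * b, 1⟩ := by
  rw [AddCircle.toCircle_nsmul, ← mk_eq_quotInl_mul, ← map_mul]
  refine congrArg _ (CentralExt.ext rfl ?_)
  simp

variable (e : A ≃* B) (c : Cocycle2 A) (c' : Cocycle2 B) (T : B → AddCircle (1 : ℝ))

/-- If `c = 2c' + δT` under `e`, then `(a, u) ↦ u exp(2πi T(a)) [(e a, 1)]` is a homomorphism from
the extension defined by `c` to the quotient by `ℤ₂` of the extension defined by `c'`. The scalar
`u exp(2πi T(a))` acts through the identification `𝕋 ⧸ ℤ₂ ≃ 𝕋`, which doubles the cocycle `c'`. -/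
noncomputable def toQuot
    (h : ∀ a b, c.toFun a b - 2 • c'.toFun (e a) (e b) = T (e b) - T (e a * e b) + T (e a)) :
    CentralExt c →* CentralExt c' ⧸ Z₂ c' :=
  MonoidHom.mk' (fun y => quotInl c' (y.fiber * (T (e y.base)).toCircle) *
    QuotientGroup.mk' (Z₂ c') ⟨e y.base, 1⟩) fun y z => by
      have hT : c.toFun y.base z.base + T (e y.base * e z.base) =
          T (e y.base) + T (e z.base) + 2 • c'.toFun (e y.base) (e z.base) := by
        rw [sub_eq_iff_eq_add.1 (h y.base z.base)]
        abel
      have hT' := congrArg AddCircle.toCircle hT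
      rw [AddCircle.toCircle_add, AddCircle.toCircle_add, AddCircle.toCircle_add] at hT'
      have hcomm : Commute (QuotientGroup.mk' (Z₂ c') ⟨e y.base, 1⟩)
          (quotInl c' (z.fiber * (T (e z.base)).toCircle)) := (quotInl_mul_comm c' _ _).symm
      rw [hcomm.mul_mul_mul_comm, mk_mul_mk, ← mul_assoc, ← map_mul, ← map_mul, mul_base, map_mul e,
        mul_fiber, mul_assoc _ (c.toFun _ _).toCircle, hT']
      refine congrArg (fun u => quotInl c' u * _) ?_
      ac_rfl

variable {e c c' T}
variable (h : ∀ a b, c.toFun a b - 2 • c'.toFun (e a) (e b) = T (e b) - T (e a * e b) + T (e a))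

theorem toQuot_apply (y : CentralExt c) : toQuot e c c' T h y =
    quotInl c' (y.fiber * (T (e y.base)).toCircle) * QuotientGroup.mk' (Z₂ c') ⟨e y.base, 1⟩ := rfl

theorem toQuot_inl (u : Circle) :
    toQuot e c c' T h ((extension c).inl u) = (quotExtension c').inl u := by
  have hT : T 1 = 0 := by
    simpa [c.map_one_one, c'.map_one_one] using (h 1 1).symm
  change quotInl c' (u * (T (e 1)).toCircle) * QuotientGroup.mk' (Z₂ c') ⟨e 1, 1⟩ = quotInl c' u
  have hone : QuotientGroup.mk' (Z₂ c') ⟨1, 1⟩ = 1 := map_one _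
  rw [map_one, hT, AddCircle.toCircle_zero, mul_one, hone, mul_one]

theorem rightHom_toQuot (y : CentralExt c) :
    (quotExtension c').rightHom (toQuot e c c' T h y) = e ((extension c).rightHom y) := by
  have hinl : (quotExtension c').rightHom
      ((quotExtension c').inl (y.fiber * (T (e y.base)).toCircle)) = 1 :=
    (quotExtension c').rightHom_inl _
  rw [toQuot_apply, map_mul]
  change (quotExtension c').rightHom ((quotExtension c').inl _) * _ = _
  rw [hinl, one_mul]
  rfl

theorem toQuot_bijective : Function.Bijective (toQuot e c c' T h) := by
  refine ⟨(injective_iff_map_eq_one _).2 fun y hy => ?_, fun x => ?_⟩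
  · have hbase : (extension c).rightHom y = 1 := by
      have := rightHom_toQuot h y
      rwa [hy, map_one, eq_comm, EmbeddingLike.map_eq_one_iff] at this
    obtain ⟨u, rfl⟩ : y ∈ (extension c).inl.range := by
      rw [(extension c).range_inl_eq_ker_rightHom]
      exact hbase
    rw [toQuot_inl] at hy
    rw [(injective_iff_map_eq_one _).1 (quotExtension c').inl_injective u hy, map_one]
  · obtain ⟨⟨b, u⟩, rfl⟩ := QuotientGroup.mk'_surjective _ x
    refine ⟨⟨e.symm b, u ^ 2 * (T b).toCircle⁻¹⟩, ?_⟩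
    rw [mk_eq_quotInl_mul, toQuot_apply]
    simp

end CentralExt

end SmoothDeligne

open SmoothDeligne in
/-- There is an isomorphism `e : 𝒢(S¹) ≃ L𝕋`, which takes the class of a Cech cocycle `(k, τ)` to
the loop `exp(2πi τ)`, such that `S(f, g) = ∫₀¹ F dG - Δ_F G(0)` and `S - 2c = δT` under `e`, and
`𝒢~(S¹)` and `LT^ / ℤ₂` are isomorphic as central extensions over `e`. -/
theorem mainTheorem3 :
    ∃ e : GaugeGroup ≃* LT,
      (∀ (𝔘 : PointedCover Circle) (z : (D1one (𝓡 1) 𝔘).ker) (a x : Circle), x ∈ 𝔘.U a →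
        e (Multiplicative.ofAdd (DeligneH1.mk (𝓡 1) 𝔘 (Cohomology.mk (D0 (𝓡 1) 𝔘) (D1one (𝓡 1) 𝔘) z))) x =
          Circle.exp (2 * Real.pi * (z.1.2 a).1 x)) ∧
      (∀ (f g : GaugeGroup) (F G : ℝ → ℝ), IsLift (e f) F → IsLift (e g) G →
        S f.toAdd g.toAdd =
          (((∫ t in (0 : ℝ)..1, F t * deriv G t) - (F 1 - F 0) * G 0 : ℝ) : AddCircle (1 : ℝ))) ∧
      (∀ f g : GaugeGroup, S f.toAdd g.toAdd - 2 • psCocycle.toFun (e f) (e g) =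
        T (e g) - T (e f * e g) + T (e f)) ∧
      ∃ Φ : GTilde ≃* LTHat ⧸ CentralExt.Z₂ psCocycle,
        (∀ u : Circle, Φ ((CentralExt.extension SCocycle).inl u) =
          (CentralExt.quotExtension psCocycle).inl u) ∧
        ∀ y : GTilde, (CentralExt.quotExtension psCocycle).rightHom (Φ y) =
          e ((CentralExt.extension SCocycle).rightHom y) := by
  have hS : ∀ f g : GaugeGroup, S f.toAdd g.toAdd -
      2 • psCocycle.toFun (deligneLoopEquiv (𝓡 1) Circle f) (deligneLoopEquiv (𝓡 1) Circle g) =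
      T (deligneLoopEquiv (𝓡 1) Circle g) - T (deligneLoopEquiv (𝓡 1) Circle f *
        deligneLoopEquiv (𝓡 1) Circle g) + T (deligneLoopEquiv (𝓡 1) Circle f) := fun f g => by
    rw [S_eq_of_isLift (isLift_lift _) (isLift_lift _)]
    exact integral_sub_two_nsmul_psFun (isLift_lift _) (isLift_lift _)
  refine ⟨deligneLoopEquiv (𝓡 1) Circle, fun 𝔘 z a x hx => ?_, fun f g F G => S_eq_of_isLift, hS,
    MulEquiv.ofBijective (CentralExt.toQuot (deligneLoopEquiv (𝓡 1) Circle) SCocycle psCocycle T hS)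
      (CentralExt.toQuot_bijective hS),
    CentralExt.toQuot_inl hS, CentralExt.rightHom_toQuot hS⟩
  rw [deligneLoopEquiv_mk, expLoop_apply z hx]
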